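/- Let $M$ be a (finite-dimensional, Hausdorff, smooth) manifold and $\tau:E\to M$ a smooth real vector bundle of finite rank with dual $\pi:E^*\to M$. Let $E$ carry a skew-symmetric algebroid structure: a skew-symmetric $\mathbb R$-bilinear bracket $[\cdot,\cdot]$ on smooth sections and a smooth vector bundle morphism $\rho:E\to TM$ with $[X,fY]=f[X,Y]+\rho(X)(f)\,Y$. Notation. For a section $X$ let $\iota_X$ be the corresponding fibrewise linear function on $E^*$. Let $\Pi$ be the linear bivector field on $E^*$ with $\Pi(d\iota_X,d\iota_Y)=\iota_{[X,Y]}$, $\Pi(d\iota_X,d(f\circ\pi))=\rho(X)(f)\circ\pi$, $\Pi(d(f\circ\pi),d(g\circ\pi))=0$; let $\widetilde\Pi:T^*E^*\to TE^*$ be contraction with $\Pi$, let $\mathcal R_E:T^*E\to T^*E^*$ be the canonical isomorphism, $(x,y,p,z)\mapsto(x,z,-p,y)$ in adapted coordinates, and put $\varepsilon=\widetilde\Pi\circ\mathcal R_E:T^*E\to TE^*$. For a manifold $Q$ let $\kappa_Q:TTQ\to TTQ$ be the canonical involution and $\alpha_Q:TT^*Q\to T^*TQ$ the canonical isomorphism.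 The *tangent lift algebroid* $d_TE$ is the structure on $T\tau:TE\to TM$ (with dual $T\pi:TE^*\to TM$) given by the bivector field $d_T\Pi$ on $TE^*$, $\widetilde{d_T\Pi}=\kappa_{E^*}\circ T\widetilde\Pi\circ\alpha_{E^*}^{-1}$; its morphism is $d_T\varepsilon=\widetilde{d_T\Pi}\circ\mathcal R_{TE}:T^*TE\to TTE^*$, where $\mathcal R_{TE}$ is the canonical isomorphism for the bundle $T\tau$. The tangent lift of a function $f$ on $Q$ is $d_Tf:TQ\to\mathbb R$, $d_Tf(u)=\langle df,u\rangle$. For a smooth Lagrangian $L:E\to\mathbb R$ put $\Lambda_L=\varepsilon\circ dL:E\to TE^*$ and $\lambda_L=\tau_{E^*}\circ\Lambda_L:E\to E^*$. A curve $\gamma:[t_0,t_1]\to E$ ($t_0<t_1$) solves the Euler–Lagrange (EL) equation of $(E,L)$ if $\lambda_L\circ\gamma$ is differentiable and $\frac{d}{dt}\lambda_L(\gamma(t))=\Lambda_L(\gamma(t))$ on $[t_0,t_1]$. The EL equation of $(d_TE,d_TL)$, for curves in $TE$, is the same equation with $d_T\varepsilon$ and $d_TL$ in place of $\varepsilon$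 and $L$. The tangent prolongation of the EL equation of $(E,L)$ is the equation $$\frac{d}{dt}\,T\lambda_L(J(t))=\kappa_{E^*}\bigl(T\Lambda_L(J(t))\bigr)\qquad(*)$$ for a curve $J:[t_0,t_1]\to TE$. Let $\kappa\subset TE\times TE$ be the relation dual to $\varepsilon$: it consists of the pairs $(X,Y)$ with $\rho(\tau_E(Y))=T\tau(X)$ and $\langle X,\varepsilon(A)\rangle_{T\tau}=\langle A,Y\rangle$ for all $A\in T^*_{\tau_E(Y)}E$, where $\langle\cdot,\cdot\rangle_{T\tau}:TE\times_{TM}TE^*\to\mathbb R$ is the tangent of the pairing of $E$ and $E^*$. If $\gamma$ solves the EL equation of $(E,L)$ and $\eta:[t_0,t_1]\to E$ is a differentiable curve with $\tau\circ\eta=\tau\circ\gamma$, the admissible variation $\delta_\eta\gamma$ is the vector field in $TE$ along $\gamma$ that is $\kappa$-related to $\dot\eta$, i.e. $\delta_\eta\gamma(t)\in T_{\gamma(t)}E$ and $(\dot\eta(t),\delta_\eta\gamma(t))\in\kappa$. The curve $\eta$ is a Jacobi vector field along $\gamma$ if $J=\delta_\eta\gamma$ satisfies $(*)$. **Theorem.**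 Let $L:E\to\mathbb R$ be a smooth Lagrangian on the skew-symmetric algebroid $E$ and $t_0<t_1$. 1. The tangent prolongation $(*)$ of the EL equation of $(E,L)$ is the EL equation of $(d_TE,d_TL)$: a curve $J:[t_0,t_1]\to TE$ satisfies $(*)$ if and only if it solves the EL equation of $(d_TE,d_TL)$. 2. Let $\gamma:[t_0,t_1]\to E$ solve the EL equation of $(E,L)$ and let $\eta:[t_0,t_1]\to E$ be a differentiable curve with $\tau\circ\eta=\tau\circ\gamma$. Then $\delta_\eta\gamma$ exists and is unique, and $\eta$ is a Jacobi vector field along $\gamma$ if and only if $\delta_\eta\gamma$ solves the EL equation of $(d_TE,d_TL)$. -/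

import Mathlib

open Bundle Set
open scoped Manifold ContDiff

noncomputable section

namespace SkewAlg

/-! ### Canonical objects on a manifold `Q`

Throughout, Mathlib's convention is used that a tangent vector at `q : Q` is its coordinate vector
in the preferred chart at `q`. The preferred charts of `TQ`, `T*Q`, `E`, `E*` at points lying over a
given base point are the ones induced by the preferred chart (and trivialization) at that base
point, so that the components of elements of the iterated bundles are their induced coordinates. -/

section Canonical

variable {W H : Type*} [NormedAddCommGroup W] [NormedSpace ℝ W] [TopologicalSpace H]
  (I : ModelWithCorners ℝ W H) (Q : Type*) [TopologicalSpace Q] [ChartedSpace H Q]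

/-- The cotangent bundle `T*Q`, as the bundle dual to the tangent bundle. -/
abbrev Cotangent : Type _ :=
  TotalSpace (W →L[ℝ] ℝ) (fun q : Q => TangentSpace I q →L[ℝ] Trivial Q ℝ q)

variable {Q}

/-- The differential of a function, as a map `Q → T*Q`. -/
def differential (f : Q → ℝ) (q : Q) : Cotangent I Q := ⟨q, mfderiv I 𝓘(ℝ, ℝ) f q⟩

/-- The tangent lift `d_T f : TQ → ℝ` of a function, the differential of `f` regarded as a
function on `TQ`. -/
def tangentLift (f : Q → ℝ) (u : TangentBundle I Q) : ℝ := mfderiv I 𝓘(ℝ, ℝ) f u.proj u.snd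

/-- The tangent prolongation at time `t` of a curve `c` defined on `s`, as an element of `TQ`. -/
def velocity (c : ℝ → Q) (s : Set ℝ) (t : ℝ) : TangentBundle I Q :=
  ⟨c t, mfderivWithin 𝓘(ℝ, ℝ) I c s t (1 : ℝ)⟩

variable (Q)
variable [IsManifold I ∞ Q]

/-- The canonical involution `κ_Q : TTQ → TTQ`, in induced coordinates
`(q, q̇, δq, δq̇) ↦ (q, δq, q̇, δq̇)`. -/
def kappa : TangentBundle I.tangent (TangentBundle I Q) →
    TangentBundle I.tangent (TangentBundle I Q) := fun A =>
  let w : W × W := A.snd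
  let v : W := A.proj.snd
  ⟨⟨A.proj.proj, w.1⟩, ((v, w.2) : W × W)⟩

/-- The canonical isomorphism `α_Q : TT*Q → T*TQ`, in induced coordinates
`(q, p, q̇, ṗ) ↦ (q, q̇, ṗ, p)`: the image of `(q, p, q̇, ṗ)` is the covector
`(δq, δq̇) ↦ ⟨ṗ, δq⟩ + ⟨p, δq̇⟩` at the point `(q, q̇)` of `TQ`. -/
def alpha : TangentBundle (I.prod 𝓘(ℝ, W →L[ℝ] ℝ)) (Cotangent I Q) ≃
    Cotangent I.tangent (TangentBundle I Q) where
  toFun Ψ :=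
    let w : W × (W →L[ℝ] ℝ) := Ψ.snd
    let p : W →L[ℝ] ℝ := Ψ.proj.snd
    ⟨⟨Ψ.proj.proj, w.1⟩, (w.2.coprod p : W × W →L[ℝ] ℝ)⟩
  invFun a :=
    let p : W × W →L[ℝ] ℝ := a.snd
    let v : W := a.proj.snd
    ⟨⟨a.proj.proj, p.comp (ContinuousLinearMap.inr ℝ W W)⟩,
      ((v, p.comp (ContinuousLinearMap.inl ℝ W W)) : W × (W →L[ℝ] ℝ))⟩
  left_inv Ψ := by
    obtain ⟨⟨q, p⟩, w⟩ := Ψ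
    have h₁ : ∀ f g : W →L[ℝ] ℝ, (f.coprod g).comp (ContinuousLinearMap.inr ℝ W W) = g :=
      fun f g => by ext; simp
    have h₂ : ∀ f g : W →L[ℝ] ℝ, (f.coprod g).comp (ContinuousLinearMap.inl ℝ W W) = f :=
      fun f g => by ext; simp
    refine congrArg₂ (fun (p' : W →L[ℝ] ℝ) (w' : W × (W →L[ℝ] ℝ)) => (⟨⟨q, p'⟩, w'⟩ :
      TangentBundle (I.prod 𝓘(ℝ, W →L[ℝ] ℝ)) (Cotangent I Q))) (h₁ _ _) (Prod.ext rfl (h₂ _ _))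
  right_inv a := by
    obtain ⟨⟨q, v⟩, p⟩ := a
    have h : ∀ f : W × W →L[ℝ] ℝ, (f.comp (ContinuousLinearMap.inl ℝ W W)).coprod
        (f.comp (ContinuousLinearMap.inr ℝ W W)) = f := fun f => by
      ext <;> simp
    exact congrArg (fun p' : W × W →L[ℝ] ℝ =>
      (⟨⟨q, v⟩, p'⟩ : Cotangent I.tangent (TangentBundle I Q))) (h _)

end Canonical

/-! ### Lagrangian dynamics of a morphism `ε : T*N → TN'` -/

section EulerLagrange

variable {W H W' H' : Type*} [NormedAddCommGroup W] [NormedSpace ℝ W] [TopologicalSpace H]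
  {I : ModelWithCorners ℝ W H} {N : Type*} [TopologicalSpace N] [ChartedSpace H N]
  [NormedAddCommGroup W'] [NormedSpace ℝ W'] [TopologicalSpace H']
  {I' : ModelWithCorners ℝ W' H'} {N' : Type*} [TopologicalSpace N'] [ChartedSpace H' N']
  (ε : Cotangent I N → TangentBundle I' N') (L : N → ℝ)

/-- The Tulczyjew differential `Λ_L = ε ∘ dL : N → TN'`. -/
def tulczyjew (v : N) : TangentBundle I' N' := ε (differential I L v)

/-- The Legendre mapping `λ_L = τ_{N'} ∘ ε ∘ dL : N → N'`. -/
def legendre (v : N) : N' := (tulczyjew ε L v).proj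

/-- The curve `γ : [t₀, t₁] → N` satisfies the Euler-Lagrange equation: `λ_L ∘ γ` is
differentiable and its tangent prolongation is `Λ_L ∘ γ`. -/
def IsELSolution (t₀ t₁ : ℝ) (γ : ℝ → N) : Prop :=
  ∀ t ∈ Icc t₀ t₁,
    MDifferentiableWithinAt 𝓘(ℝ, ℝ) I' (fun s => legendre ε L (γ s)) (Icc t₀ t₁) t ∧
    velocity I' (fun s => legendre ε L (γ s)) (Icc t₀ t₁) t = tulczyjew ε L (γ t)

/-- The curve `J : [t₀, t₁] → TN` satisfies the tangent prolongation
`d/dt (Tλ_L (J t)) = κ_{N'} (TΛ_L (J t))` of the Euler-Lagrange equation. -/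
def IsProlongedELSolution [IsManifold I' ∞ N'] (t₀ t₁ : ℝ) (J : ℝ → TangentBundle I N) : Prop :=
  ∀ t ∈ Icc t₀ t₁,
    MDifferentiableWithinAt 𝓘(ℝ, ℝ) I'.tangent
      (fun s => tangentMap I I' (legendre ε L) (J s)) (Icc t₀ t₁) t ∧
    velocity I'.tangent (fun s => tangentMap I I' (legendre ε L) (J s)) (Icc t₀ t₁) t =
      kappa I' N' (tangentMap I I'.tangent (tulczyjew ε L) (J t))

end EulerLagrange

/-! ### Skew-symmetric algebroids -/

section Algebroid

variable {B : Type*} [NormedAddCommGroup B] [NormedSpace ℝ B]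
  {M : Type*} [TopologicalSpace M] [ChartedSpace B M] [IsManifold 𝓘(ℝ, B) ∞ M]
  (F : Type*) [NormedAddCommGroup F] [NormedSpace ℝ F]
  (E : M → Type*) [∀ x, AddCommGroup (E x)] [∀ x, Module ℝ (E x)] [∀ x, TopologicalSpace (E x)]
  [TopologicalSpace (TotalSpace F E)] [FiberBundle F E] [VectorBundle ℝ F E]
  [ContMDiffVectorBundle ∞ F E 𝓘(ℝ, B)]

/-- The total space of the dual bundle `π : E* → M`. -/
abbrev DualBundle : Type _ :=
  TotalSpace (F →L[ℝ] ℝ) (fun x : M => E x →L[ℝ] Trivial M ℝ x)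

/-- The model with corners of the manifold `E`. -/
abbrev modelE (B F : Type*) [NormedAddCommGroup B] [NormedSpace ℝ B] [NormedAddCommGroup F]
    [NormedSpace ℝ F] : ModelWithCorners ℝ (B × F) (ModelProd B F) := 𝓘(ℝ, B).prod 𝓘(ℝ, F)

/-- The model with corners of the manifold `E*`. -/
abbrev modelDual (B F : Type*) [NormedAddCommGroup B] [NormedSpace ℝ B] [NormedAddCommGroup F]
    [NormedSpace ℝ F] : ModelWithCorners ℝ (B × (F →L[ℝ] ℝ)) (ModelProd B (F →L[ℝ] ℝ)) :=
  𝓘(ℝ, B).prod 𝓘(ℝ, F →L[ℝ] ℝ)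

/-- A skew-symmetric algebroid structure on the vector bundle `E → M`. -/
structure SkewAlgebroid where
  /-- the bracket on the smooth sections of `E` -/
  bracket : ContMDiffSection 𝓘(ℝ, B) F ∞ E →ₗ[ℝ] ContMDiffSection 𝓘(ℝ, B) F ∞ E →ₗ[ℝ]
    ContMDiffSection 𝓘(ℝ, B) F ∞ E
  /-- the anchor map -/
  anchor : ∀ x : M, E x →L[ℝ] TangentSpace 𝓘(ℝ, B) x
  contMDiff_anchor : ContMDiff (modelE B F) 𝓘(ℝ, B).tangent ∞
    (fun v : TotalSpace F E => (⟨v.proj, anchor v.proj v.snd⟩ : TangentBundle 𝓘(ℝ, B) M))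
  skew : ∀ X Y, bracket X Y = -bracket Y X
  leibniz : ∀ (X Y Z : ContMDiffSection 𝓘(ℝ, B) F ∞ E) (f : M → ℝ), ContMDiff 𝓘(ℝ, B) 𝓘(ℝ, ℝ) ∞ f →
    (∀ x, Z x = f x • Y x) → ∀ x,
      bracket X Z x = f x • bracket X Y x + tangentLift 𝓘(ℝ, B) f ⟨x, anchor x (X x)⟩ • Y x

variable {F E}

/-- The coordinate in `F` of a point `v : E`, in the preferred trivialization at its base point. -/
def fibreCoord (v : TotalSpace F E) : F := (trivializationAt F E v.proj v).2

/-- The coordinate in `F*` of a point `z : E*`, in the preferred trivialization at its base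
point. -/
def dualCoord (z : DualBundle F E) : F →L[ℝ] ℝ :=
  (trivializationAt (F →L[ℝ] ℝ) (fun x : M => E x →L[ℝ] Trivial M ℝ x) z.proj z).2

/-- The natural pairing `⟨u, w⟩_{Tτ}` between `Tτ : TE → TM` and `Tπ : TE* → TM`, for `u` and `w`
over the same tangent vector of `M`. It is the derivative of the pairing of `E` and `E*`:
`⟨(x, y, ẋ, ẏ), (x, z, ẋ, ż)⟩ = z ẏ + ż y`. -/
def tangentPairing (u : TangentBundle (modelE B F) (TotalSpace F E))
    (w : TangentBundle (modelDual B F) (DualBundle F E)) : ℝ :=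
  let u' : B × F := u.snd
  let w' : B × (F →L[ℝ] ℝ) := w.snd
  dualCoord w.proj u'.2 + w'.2 (fibreCoord u.proj)

/-- The canonical isomorphism `R_E : T*E → T*E*`, in coordinates `(x, y, p, z) ↦ (x, z, -p, y)`.
Intrinsically, `A` at `v` is sent to the point `z` of `E*` given by the restriction of `A` to vertical
vectors, and `⟨R_E A, w⟩ + ⟨A, u⟩ = ⟨u, w⟩_{Tτ}` for `u` at `v` and `w` at `z` with `Tτ u = Tπ w`. -/
def dualityE (A : Cotangent (modelE B F) (TotalSpace F E)) :
    Cotangent (modelDual B F) (DualBundle F E) :=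
  let a : B × F →L[ℝ] ℝ := A.snd
  let p : B →L[ℝ] ℝ := a.comp (ContinuousLinearMap.inl ℝ B F)
  let z : F →L[ℝ] ℝ := a.comp (ContinuousLinearMap.inr ℝ B F)
  ⟨⟨A.proj.proj, z.comp ((trivializationAt F E A.proj.proj).continuousLinearMapAt ℝ A.proj.proj)⟩,
    ((-p).coprod (ContinuousLinearMap.apply ℝ ℝ (fibreCoord A.proj)) :
      B × (F →L[ℝ] ℝ) →L[ℝ] ℝ)⟩

/-- The canonical isomorphism `R_{TE} : T*TE → T*TE*` of the vector bundle `Tτ : TE → TM`, whose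
dual is `Tπ : TE* → TM`. Over the base point `(x, ẋ)`, the fibre coordinates are `(y, ẏ)` on `TE`
and, by the formula for `⟨·, ·⟩_{Tτ}`, the dual ones are `(ż, z)` on `TE*`. Hence the covector with
components `(p, r, p', r')` on `(δx, δy, δẋ, δẏ)` at `(x, y, ẋ, ẏ)` is sent to the point
`(x, z, ẋ, ż) = (x, r', ẋ, r)` and the covector with components `(-p, ẏ, -p', y)` on
`(δx, δz, δẋ, δż)`. -/
def dualityTE (A : Cotangent (modelE B F).tangent (TangentBundle (modelE B F) (TotalSpace F E))) :
    Cotangent (modelDual B F).tangent (TangentBundle (modelDual B F) (DualBundle F E)) :=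
  let a : (B × F) × (B × F) →L[ℝ] ℝ := A.snd
  let c : B × F →L[ℝ] ℝ := a.comp (ContinuousLinearMap.inl ℝ (B × F) (B × F))
  let c' : B × F →L[ℝ] ℝ := a.comp (ContinuousLinearMap.inr ℝ (B × F) (B × F))
  let p : B →L[ℝ] ℝ := c.comp (ContinuousLinearMap.inl ℝ B F)
  let r : F →L[ℝ] ℝ := c.comp (ContinuousLinearMap.inr ℝ B F)
  let p' : B →L[ℝ] ℝ := c'.comp (ContinuousLinearMap.inl ℝ B F)
  let r' : F →L[ℝ] ℝ := c'.comp (ContinuousLinearMap.inr ℝ B F)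
  let x : M := A.proj.proj.proj
  let y : F := fibreCoord A.proj.proj
  let dv : B × F := A.proj.snd
  ⟨⟨⟨x, r'.comp ((trivializationAt F E x).continuousLinearMapAt ℝ x)⟩,
      ((dv.1, r) : B × (F →L[ℝ] ℝ))⟩,
    (((-p).coprod (ContinuousLinearMap.apply ℝ ℝ dv.2)).coprod
      ((-p').coprod (ContinuousLinearMap.apply ℝ ℝ y)) :
        (B × (F →L[ℝ] ℝ)) × (B × (F →L[ℝ] ℝ)) →L[ℝ] ℝ)⟩

namespace SkewAlgebroid

variable (𝔸 : SkewAlgebroid (B := B) F E)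

/-- The anchor `ρ : E → TM` as a map of total spaces. -/
def rho (v : TotalSpace F E) : TangentBundle 𝓘(ℝ, B) M := ⟨v.proj, 𝔸.anchor v.proj v.snd⟩

/-- The function `ι_X : E* → ℝ`, linear on the fibres, given by a section `X` of `E`. -/
def linearFunction (X : ContMDiffSection 𝓘(ℝ, B) F ∞ E) (z : DualBundle F E) : ℝ :=
  z.snd (X z.proj)

/-- `w` is the contraction with the covector `ψ` of the linear bivector field `Π` on `E*`
determined by `Π(dι_X, dι_Y) = ι_[X,Y]`, `Π(dι_X, d(f ∘ π)) = ρ(X)(f) ∘ π`,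
`Π(d(f ∘ π), d(g ∘ π)) = 0`: whenever `ψ = d(ι_X + f ∘ π)` at the point `z`, then
`⟨d(g ∘ π), w⟩ = ρ(X)(g)`, i.e. `Tπ w = ρ(X)`, and `⟨dι_Y, w⟩ = ⟨z, [X, Y]⟩ - ρ(Y)(f)`. -/
def IsContraction (ψ : Cotangent (modelDual B F) (DualBundle F E))
    (w : TangentSpace (modelDual B F) ψ.proj) : Prop :=
  ∀ (X : ContMDiffSection 𝓘(ℝ, B) F ∞ E) (f : M → ℝ), ContMDiff 𝓘(ℝ, B) 𝓘(ℝ, ℝ) ∞ f →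
    differential (modelDual B F) (fun z : DualBundle F E => linearFunction X z + f z.proj) ψ.proj
      = ψ →
    mfderiv (modelDual B F) 𝓘(ℝ, B) (fun z : DualBundle F E => z.proj) ψ.proj w =
      𝔸.anchor ψ.proj.proj (X ψ.proj.proj) ∧
    ∀ Y : ContMDiffSection 𝓘(ℝ, B) F ∞ E,
      tangentLift (modelDual B F) (linearFunction Y : DualBundle F E → ℝ) ⟨ψ.proj, w⟩ =
        linearFunction (𝔸.bracket X Y) ψ.proj -
          tangentLift 𝓘(ℝ, B) f ⟨ψ.proj.proj, 𝔸.anchor ψ.proj.proj (Y ψ.proj.proj)⟩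

/-- The morphism `Π̃ : T*E* → TE*`: contraction with the linear bivector field `Π` on `E*`, i.e. the
unique vector satisfying `IsContraction`. -/
def sharp (ψ : Cotangent (modelDual B F) (DualBundle F E)) :
    TangentBundle (modelDual B F) (DualBundle F E) :=
  ⟨ψ.proj, Classical.epsilon (𝔸.IsContraction ψ)⟩

/-- The morphism `ε = Π̃ ∘ R_E : T*E → TE*`. -/
def eps (A : Cotangent (modelE B F) (TotalSpace F E)) :
    TangentBundle (modelDual B F) (DualBundle F E) := 𝔸.sharp (dualityE A)

/-- The relation `κ ⊂ TE × TE` dual to `ε`. -/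
def KappaRel (X Y : TangentBundle (modelE B F) (TotalSpace F E)) : Prop :=
  𝔸.rho Y.proj = tangentMap (modelE B F) 𝓘(ℝ, B) (fun v : TotalSpace F E => v.proj) X ∧
  ∀ A : TangentSpace (modelE B F) Y.proj →L[ℝ] ℝ,
    tangentPairing X (𝔸.eps ⟨Y.proj, A⟩) = A Y.snd

/-- The infinitesimal admissible variation `δ_ξ γ` of `γ` generated by `ξ`, for curves on `s`: the
unique vector field in `TE` along `γ` that is `κ`-related to the tangent prolongation of `ξ`. -/
def admissibleVariation (s : Set ℝ) (γ ξ : ℝ → TotalSpace F E) (t : ℝ) :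
    TangentBundle (modelE B F) (TotalSpace F E) :=
  ⟨γ t, Classical.epsilon fun Y : TangentSpace (modelE B F) (γ t) =>
    𝔸.KappaRel (velocity (modelE B F) ξ s t) ⟨γ t, Y⟩⟩

/-- The tangent lift `d_T Π` of the bivector field `Π`, as the morphism
`κ_{E*} ∘ TΠ̃ ∘ α_{E*}⁻¹ : T*TE* → TTE*`. It defines the tangent lift algebroid `d_T E`. -/
def liftSharp (Φ : Cotangent (modelDual B F).tangent
      (TangentBundle (modelDual B F) (DualBundle F E))) :
    TangentBundle (modelDual B F).tangent (TangentBundle (modelDual B F) (DualBundle F E)) :=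
  kappa (modelDual B F) (DualBundle F E)
    (tangentMap ((modelDual B F).prod 𝓘(ℝ, (B × (F →L[ℝ] ℝ)) →L[ℝ] ℝ)) (modelDual B F).tangent
      𝔸.sharp ((alpha (modelDual B F) (DualBundle F E)).symm Φ))

/-- The morphism `d_T ε : T*TE → TTE*` of the tangent lift algebroid `d_T E`. -/
def liftEps (A : Cotangent (modelE B F).tangent
      (TangentBundle (modelE B F) (TotalSpace F E))) :
    TangentBundle (modelDual B F).tangent (TangentBundle (modelDual B F) (DualBundle F E)) :=
  𝔸.liftSharp (dualityTE A)

/-- `η` is a Jacobi vector field along the solution `γ` of the Euler-Lagrange equation: a curve in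
`E` over the same base path whose admissible variation satisfies the Jacobi equation. -/
def IsJacobiField (L : TotalSpace F E → ℝ) (t₀ t₁ : ℝ) (γ η : ℝ → TotalSpace F E) : Prop :=
  (∀ t ∈ Icc t₀ t₁, (η t).proj = (γ t).proj) ∧
  MDifferentiableOn 𝓘(ℝ, ℝ) (modelE B F) η (Icc t₀ t₁) ∧
  IsProlongedELSolution 𝔸.eps L t₀ t₁ (𝔸.admissibleVariation (Icc t₀ t₁) γ η)

end SkewAlgebroid

end Algebroid

end SkewAlg

end

/-!
In the charts of `E*` and `T*E*` induced by a chart of `M` and a trivialization of `E`, the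
contraction `Π̃` is an explicit smooth map, because near a point every section of `E` is a
combination of sections with constant components, to which the Leibniz rule applies. The identity
behind the first part is `T(R_E ∘ dL) = α⁻¹ ∘ R_{TE} ∘ d(d_T L)`: in coordinates it says that the
second derivative of `L` is symmetric. Composing it with `κ ∘ TΠ̃` gives `κ ∘ TΛ_L = Λ_{d_T L}`, and
projecting to `TE*` gives `Tλ_L = λ_{d_T L}`, so that the two equations for `J` are literally the
same.

For the second part, the equation on the base hidden in the Euler-Lagrange equation is
`ρ ∘ γ = d/dt (τ ∘ γ)`. It makes the base components of the relation `κ` between `dη/dt` and a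
vector at `γ t` match, and then `κ` says that the vector represents the linear form
`A ↦ ⟨dη/dt, ε(A)⟩` on the covectors at `γ t`; such a vector exists and is unique.
-/

noncomputable section

namespace SkewAlg

open Filter Topology

section ChartDeriv

variable {W H : Type*} [NormedAddCommGroup W] [NormedSpace ℝ W] [TopologicalSpace H]
  {I : ModelWithCorners ℝ W H} {Q : Type*} [TopologicalSpace Q] [ChartedSpace H Q]
  {G : Type*} [NormedAddCommGroup G] [NormedSpace ℝ G]

variable (I) in
/-- The derivative at `q` of a vector-valued function, in the coordinates of the preferred chart
at `q₀`. -/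
def chartDeriv (f : Q → G) (q₀ q : Q) : W →L[ℝ] G :=
  fderiv ℝ (f ∘ (extChartAt I q₀).symm) (extChartAt I q₀ q)

theorem chartDeriv_const (c : G) (q₀ q : Q) : chartDeriv I (fun _ => c) q₀ q = 0 :=
  fderiv_const_apply _

theorem chartDeriv_neg (f : Q → G) (q₀ q : Q) :
    chartDeriv I (fun q => -f q) q₀ q = -chartDeriv I f q₀ q :=
  fderiv_fun_neg

theorem tendsto_extChartAt_symm {q₀ q : Q} (hq : q ∈ (chartAt H q₀).source) :
    Tendsto (extChartAt I q₀).symm (𝓝 (extChartAt I q₀ q)) (𝓝 q) := by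
  rw [← extChartAt_source I] at hq
  simpa only [ContinuousAt, (extChartAt I q₀).left_inv hq] using continuousAt_extChartAt_symm' hq

theorem extChartAt_symm_extChartAt {q₀ q : Q} (hq : q ∈ (chartAt H q₀).source) :
    (extChartAt I q₀).symm (extChartAt I q₀ q) = q :=
  (extChartAt I q₀).left_inv (by rwa [extChartAt_source])

theorem chartDeriv_congr {f g : Q → G} {q₀ q : Q} (hq : q ∈ (chartAt H q₀).source)
    (h : f =ᶠ[𝓝 q] g) : chartDeriv I f q₀ q = chartDeriv I g q₀ q :=
  (h.comp_tendsto (tendsto_extChartAt_symm hq)).fderiv_eq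

variable [I.Boundaryless]

theorem chartDeriv_eq_of_eventually {f : Q → G} {q₀ q : Q} (hq : q ∈ (chartAt H q₀).source)
    {g : W → G} {g' : W →L[ℝ] G} (hfg : ∀ᶠ q' in 𝓝 q, f q' = g (extChartAt I q₀ q'))
    (hg : HasFDerivAt g g' (extChartAt I q₀ q)) : chartDeriv I f q₀ q = g' := by
  have hfg' : f ∘ (extChartAt I q₀).symm =ᶠ[𝓝 (extChartAt I q₀ q)] g := by
    filter_upwards [(tendsto_extChartAt_symm hq).eventually hfg,
      extChartAt_target_mem_nhds'
        ((extChartAt I q₀).map_source ((extChartAt_source I q₀).symm ▸ hq))] with ξ hξ hξt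
    rw [Function.comp_apply, hξ, (extChartAt I q₀).right_inv hξt]
  rw [chartDeriv, hfg'.fderiv_eq, hg.fderiv]

theorem mfderiv_eq_chartDeriv {f : Q → G} {q : Q} (hf : MDifferentiableAt I 𝓘(ℝ, G) f q) :
    mfderiv I 𝓘(ℝ, G) f q = chartDeriv I f q q := by
  rw [hf.mfderiv, I.range_eq_univ, fderivWithin_univ]
  rfl

theorem contDiffAt_comp_extChartAt_symm {n : WithTop ℕ∞} [IsManifold I n Q] {f : Q → G} {q₀ q : Q}
    (hq : q ∈ (chartAt H q₀).source) (hf : ContMDiffAt I 𝓘(ℝ, G) n f q) :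
    ContDiffAt ℝ n (f ∘ (extChartAt I q₀).symm) (extChartAt I q₀ q) := by
  rw [← extChartAt_source I] at hq
  have hsymm : ContMDiffAt 𝓘(ℝ, W) I n (extChartAt I q₀).symm (extChartAt I q₀ q) :=
    (contMDiffOn_extChartAt_symm q₀).contMDiffAt
      (extChartAt_target_mem_nhds' ((extChartAt I q₀).map_source hq))
  refine (ContMDiffAt.comp _ ?_ hsymm).contDiffAt
  rwa [(extChartAt I q₀).left_inv hq]

variable [IsManifold I 1 Q]

theorem hasFDerivAt_comp_extChartAt_symm {f : Q → G} {q₀ q : Q} (hq : q ∈ (chartAt H q₀).source)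
    (hf : MDifferentiableAt I 𝓘(ℝ, G) f q) :
    HasFDerivAt (f ∘ (extChartAt I q₀).symm) (chartDeriv I f q₀ q) (extChartAt I q₀ q) := by
  rw [← extChartAt_source I] at hq
  have hsymm := mdifferentiableWithinAt_extChartAt_symm (I := I) ((extChartAt I q₀).map_source hq)
  rw [I.range_eq_univ, mdifferentiableWithinAt_univ] at hsymm
  refine (MDifferentiableAt.comp _ ?_ hsymm).differentiableAt.hasFDerivAt
  rwa [(extChartAt I q₀).left_inv hq]

theorem chartDeriv_add {f g : Q → G} {q₀ q : Q} (hq : q ∈ (chartAt H q₀).source)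
    (hf : MDifferentiableAt I 𝓘(ℝ, G) f q) (hg : MDifferentiableAt I 𝓘(ℝ, G) g q) :
    chartDeriv I (fun q => f q + g q) q₀ q = chartDeriv I f q₀ q + chartDeriv I g q₀ q :=
  ((hasFDerivAt_comp_extChartAt_symm hq hf).add (hasFDerivAt_comp_extChartAt_symm hq hg)).fderiv

theorem chartDeriv_clm_comp {G' : Type*} [NormedAddCommGroup G'] [NormedSpace ℝ G']
    (ℓ : G →L[ℝ] G') {f : Q → G} {q₀ q : Q} (hq : q ∈ (chartAt H q₀).source)
    (hf : MDifferentiableAt I 𝓘(ℝ, G) f q) :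
    chartDeriv I (fun q => ℓ (f q)) q₀ q = ℓ.comp (chartDeriv I f q₀ q) :=
  (ℓ.hasFDerivAt.comp _ (hasFDerivAt_comp_extChartAt_symm hq hf)).fderiv

theorem mfderiv_apply_eq_chartDeriv {f : Q → G} {q₀ q : Q} (hq : q ∈ (chartAt H q₀).source)
    (hf : MDifferentiableAt I 𝓘(ℝ, G) f q) (w : TangentSpace I q) :
    mfderiv I 𝓘(ℝ, G) f q w =
      chartDeriv I f q₀ q (mfderiv I 𝓘(ℝ, W) (extChartAt I q₀) q w) := by
  have hf' : f =ᶠ[𝓝 q] (f ∘ (extChartAt I q₀).symm) ∘ extChartAt I q₀ := by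
    filter_upwards [(chartAt H q₀).open_source.mem_nhds hq] with x hx
    exact congrArg f (extChartAt_symm_extChartAt hx).symm
  rw [hf'.mfderiv_eq, mfderiv_comp (I' := 𝓘(ℝ, W)) q
    (hasFDerivAt_comp_extChartAt_symm hq hf).differentiableAt.mdifferentiableAt
    (mdifferentiableAt_extChartAt hq), mfderiv_eq_fderiv]
  rfl

end ChartDeriv

section MFDeriv

variable {W H W' H' : Type*} [NormedAddCommGroup W] [NormedSpace ℝ W] [TopologicalSpace H]
  {I : ModelWithCorners ℝ W H} {Q : Type*} [TopologicalSpace Q] [ChartedSpace H Q]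
  [NormedAddCommGroup W'] [NormedSpace ℝ W'] [TopologicalSpace H']
  {I' : ModelWithCorners ℝ W' H'} {Q' : Type*} [TopologicalSpace Q'] [ChartedSpace H' Q']

theorem hasMFDerivAt_of_extChartAt_comp_eventuallyEq {f : Q → Q'} {q : Q} {g : W → W'}
    {g' : W →L[ℝ] W'} (hf : ∀ᶠ x in 𝓝 q, f x ∈ (chartAt H' (f q)).source)
    (hfg : ∀ᶠ x in 𝓝 q, extChartAt I' (f q) (f x) = g (extChartAt I q x))
    (hg : HasFDerivAt g g' (extChartAt I q q)) : HasMFDerivAt I I' f q g' := by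
  constructor
  · have hcont : ContinuousAt (fun x => (extChartAt I' (f q)).symm (g (extChartAt I q x))) q := by
      refine ContinuousAt.comp ?_ (hg.continuousAt.comp (continuousAt_extChartAt q))
      rw [← hfg.self_of_nhds]
      exact continuousAt_extChartAt_symm (f q)
    refine hcont.congr ?_
    filter_upwards [hf, hfg] with x hx hxg
    rw [← hxg, extChartAt_symm_extChartAt hx]
  · refine hg.hasFDerivWithinAt.congr_of_eventuallyEq ?_ ?_
    · filter_upwards [((tendsto_extChartAt_symm (mem_chart_source H q)).mono_left
        nhdsWithin_le_nhds).eventually hfg, extChartAt_target_mem_nhdsWithin (I := I) q]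
        with ξ hξ hξt
      rw [writtenInExtChartAt, Function.comp_apply, Function.comp_apply, hξ,
        (extChartAt I q).right_inv hξt]
    · simpa only [writtenInExtChartAt, Function.comp_apply, extChartAt_to_inv] using
        hfg.self_of_nhds

end MFDeriv

section BundleCharts

variable {W H : Type*} [NormedAddCommGroup W] [NormedSpace ℝ W] [TopologicalSpace H]
  {I : ModelWithCorners ℝ W H} {Q : Type*} [TopologicalSpace Q] [ChartedSpace H Q]
  {F : Type*} [NormedAddCommGroup F] {E : Q → Type*} [∀ x, TopologicalSpace (E x)]
  [TopologicalSpace (TotalSpace F E)] [FiberBundle F E]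

theorem mem_chartAt_totalSpace_source {v₀ v : TotalSpace F E} :
    v ∈ (chartAt (ModelProd H F) v₀).source ↔
      v.proj ∈ (trivializationAt F E v₀.proj).baseSet ∧ v.proj ∈ (chartAt H v₀.proj).source := by
  rw [FiberBundle.chartedSpace_chartAt]
  simp only [mfld_simps]
  rw [Trivialization.mem_source]
  exact and_congr_right fun hv => by rw [Trivialization.coe_fst' _ hv]

theorem eventually_proj_mem_baseSet {x₀ : Q} {v : TotalSpace F E}
    (hv : v.proj ∈ (trivializationAt F E x₀).baseSet) :
    ∀ᶠ v' in 𝓝 v, v'.proj ∈ (trivializationAt F E x₀).baseSet :=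
  (FiberBundle.continuous_proj F E).continuousAt.eventually
    ((trivializationAt F E x₀).open_baseSet.mem_nhds hv)

variable [NormedSpace ℝ F]

theorem extChartAt_totalSpace_apply {v₀ v : TotalSpace F E}
    (hv : v.proj ∈ (trivializationAt F E v₀.proj).baseSet) :
    extChartAt (I.prod 𝓘(ℝ, F)) v₀ v =
      (extChartAt I v₀.proj v.proj, (trivializationAt F E v₀.proj v).2) := by
  rw [FiberBundle.extChartAt]
  simp only [mfld_simps]
  rw [Trivialization.coe_fst' _ hv]

theorem hasMFDerivAt_totalSpace_proj (v : TotalSpace F E) :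
    HasMFDerivAt (I.prod 𝓘(ℝ, F)) I (fun v : TotalSpace F E => v.proj) v
      (ContinuousLinearMap.fst ℝ W F) := by
  refine hasMFDerivAt_of_extChartAt_comp_eventuallyEq
    ((FiberBundle.continuous_proj F E).continuousAt.eventually (chart_source_mem_nhds H v.proj))
    ?_ hasFDerivAt_fst
  filter_upwards [eventually_proj_mem_baseSet (mem_baseSet_trivializationAt F E v.proj)] with v' hv'
  rw [extChartAt_totalSpace_apply hv']

end BundleCharts

section VectorBundleCharts

variable {W H : Type*} [NormedAddCommGroup W] [NormedSpace ℝ W] [TopologicalSpace H]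
  {I : ModelWithCorners ℝ W H} {Q : Type*} [TopologicalSpace Q] [ChartedSpace H Q]
  {F : Type*} [NormedAddCommGroup F] [NormedSpace ℝ F]
  {E : Q → Type*} [∀ x, AddCommGroup (E x)] [∀ x, Module ℝ (E x)] [∀ x, TopologicalSpace (E x)]
  [TopologicalSpace (TotalSpace F E)] [FiberBundle F E] [VectorBundle ℝ F E]
  {G : Type*} [NormedAddCommGroup G] [NormedSpace ℝ G]

theorem trivializationAt_snd_eq_continuousLinearMapAt {x₀ : Q} {v : TotalSpace F E}
    (hv : v.proj ∈ (trivializationAt F E x₀).baseSet) :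
    (trivializationAt F E x₀ v).2 =
      (trivializationAt F E x₀).continuousLinearMapAt ℝ v.proj v.snd :=
  (congrFun (Trivialization.coe_linearMapAt_of_mem (R := ℝ) _ hv) v.snd).symm

theorem extChartAt_totalSpace_symm_apply {v₀ : TotalSpace F E} {p : W × F}
    (hp : (extChartAt I v₀.proj).symm p.1 ∈ (trivializationAt F E v₀.proj).baseSet) :
    (extChartAt (I.prod 𝓘(ℝ, F)) v₀).symm p =
      ⟨(extChartAt I v₀.proj).symm p.1,
        (trivializationAt F E v₀.proj).symmL ℝ ((extChartAt I v₀.proj).symm p.1) p.2⟩ := by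
  rw [Trivialization.symmL_apply _ hp, Trivialization.mk_symm _ hp, FiberBundle.extChartAt]
  rfl

theorem chartDeriv_vertical [I.Boundaryless] [IsManifold (I.prod 𝓘(ℝ, F)) 1 (TotalSpace F E)]
    {f : TotalSpace F E → G} {v₀ v : TotalSpace F E}
    (hv : v ∈ (chartAt (ModelProd H F) v₀).source)
    (hf : MDifferentiableAt (I.prod 𝓘(ℝ, F)) 𝓘(ℝ, G) f v) (e : E v.proj) :
    chartDeriv (I.prod 𝓘(ℝ, F)) f v₀ v
        (0, (trivializationAt F E v₀.proj).continuousLinearMapAt ℝ v.proj e) =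
      deriv (fun s : ℝ => f ⟨v.proj, v.snd + s • e⟩) 0 := by
  obtain ⟨hb, hc⟩ := mem_chartAt_totalSpace_source.1 hv
  set T := (trivializationAt F E v₀.proj).continuousLinearMapAt ℝ v.proj
  let line : ℝ → W × F := fun s => (extChartAt I v₀.proj v.proj, T v.snd + s • T e)
  have hline₀ : line 0 = extChartAt (I.prod 𝓘(ℝ, F)) v₀ v := by
    rw [extChartAt_totalSpace_apply hb, trivializationAt_snd_eq_continuousLinearMapAt hb]
    simp [line, T]
  have hline : HasDerivAt line (0, T e) 0 := by
    refine (hasDerivAt_const _ _).prodMk ?_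
    simpa using ((hasDerivAt_id (0 : ℝ)).smul_const (T e)).const_add (T v.snd)
  have hfline : (fun s : ℝ => f ⟨v.proj, v.snd + s • e⟩) =
      (f ∘ (extChartAt (I.prod 𝓘(ℝ, F)) v₀).symm) ∘ line := by
    funext s
    have hproj : (extChartAt I v₀.proj).symm (line s).1 = v.proj := extChartAt_symm_extChartAt hc
    rw [Function.comp_apply, Function.comp_apply,
      extChartAt_totalSpace_symm_apply (by rwa [hproj]), hproj]
    congr 2
    simp only [line, ← map_smul, ← map_add]
    exact (Trivialization.symmL_continuousLinearMapAt _ hb _).symm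
  have hderiv := hasFDerivAt_comp_extChartAt_symm hv hf
  rw [← hline₀] at hderiv
  rw [hfline, (hderiv.comp_hasDerivAt 0 hline).deriv]

end VectorBundleCharts

section DualComponents

variable {Q : Type*} [TopologicalSpace Q] {F : Type*} [NormedAddCommGroup F] [NormedSpace ℝ F]
  {E : Q → Type*} [∀ x, AddCommGroup (E x)] [∀ x, Module ℝ (E x)] [∀ x, TopologicalSpace (E x)]
  [TopologicalSpace (TotalSpace F E)] [FiberBundle F E] [VectorBundle ℝ F E]

/-- The coordinates of an element of a dual bundle in the preferred trivialization at `x₀`. For a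
cotangent bundle, they are the components of a covector in the preferred chart at `x₀`. -/
def dualComponents (x₀ : Q) (z : DualBundle F E) : F →L[ℝ] ℝ :=
  (trivializationAt (F →L[ℝ] ℝ) (fun x : Q => E x →L[ℝ] Trivial Q ℝ x) x₀ z).2

theorem dualComponents_apply (x₀ : Q) (z : DualBundle F E) (y : F) :
    dualComponents x₀ z y = z.snd ((trivializationAt F E x₀).symmL ℝ z.proj y) :=
  DFunLike.congr_fun (Trivial.continuousLinearMapAt_trivialization ℝ Q ℝ z.proj)
    (z.snd ((trivializationAt F E x₀).symmL ℝ z.proj y))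

theorem dualComponents_continuousLinearMapAt {x₀ : Q} {z : DualBundle F E}
    (hz : z.proj ∈ (trivializationAt F E x₀).baseSet) (v : E z.proj) :
    dualComponents x₀ z ((trivializationAt F E x₀).continuousLinearMapAt ℝ z.proj v) =
      z.snd v := by
  rw [dualComponents_apply, Trivialization.symmL_continuousLinearMapAt _ hz]

theorem mem_baseSet_trivializationAt_dual {x₀ x : Q} :
    x ∈ (trivializationAt (F →L[ℝ] ℝ) (fun x : Q => E x →L[ℝ] Trivial Q ℝ x) x₀).baseSet ↔
      x ∈ (trivializationAt F E x₀).baseSet := by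
  rw [hom_trivializationAt_baseSet]
  exact and_iff_left (mem_univ x)

theorem eq_of_dualComponents_eq {x₀ : Q} {z z' : DualBundle F E} (hproj : z.proj = z'.proj)
    (hz : z.proj ∈ (trivializationAt F E x₀).baseSet)
    (h : dualComponents x₀ z = dualComponents x₀ z') : z = z' := by
  obtain ⟨x, ζ⟩ := z
  obtain ⟨x', ζ'⟩ := z'
  obtain rfl : x = x' := hproj
  refine congrArg (TotalSpace.mk x) (ContinuousLinearMap.ext fun e => ?_)
  exact (dualComponents_continuousLinearMapAt (z := ⟨x, ζ⟩) hz e).symm.trans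
    ((DFunLike.congr_fun h _).trans (dualComponents_continuousLinearMapAt (z := ⟨x, ζ'⟩) hz e))

variable {W H : Type*} [NormedAddCommGroup W] [NormedSpace ℝ W] [TopologicalSpace H]
  {I : ModelWithCorners ℝ W H} [ChartedSpace H Q]

theorem mem_chartAt_dual_source {z₀ z : DualBundle F E} :
    z ∈ (chartAt (ModelProd H (F →L[ℝ] ℝ)) z₀).source ↔
      z.proj ∈ (trivializationAt F E z₀.proj).baseSet ∧ z.proj ∈ (chartAt H z₀.proj).source := by
  rw [mem_chartAt_totalSpace_source, mem_baseSet_trivializationAt_dual]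

theorem extChartAt_dual_apply {z₀ z : DualBundle F E}
    (hz : z.proj ∈ (trivializationAt F E z₀.proj).baseSet) :
    extChartAt (I.prod 𝓘(ℝ, F →L[ℝ] ℝ)) z₀ z =
      (extChartAt I z₀.proj z.proj, dualComponents z₀.proj z) :=
  extChartAt_totalSpace_apply (mem_baseSet_trivializationAt_dual.2 hz)

theorem contMDiffAt_dualComponents {n : WithTop ℕ∞} [ContMDiffVectorBundle n F E I]
    [IsManifold I n Q] {x₀ : Q} {z : DualBundle F E}
    (hz : z.proj ∈ (trivializationAt F E x₀).baseSet) :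
    ContMDiffAt (I.prod 𝓘(ℝ, F →L[ℝ] ℝ)) 𝓘(ℝ, F →L[ℝ] ℝ) n
      (fun z : DualBundle F E => dualComponents x₀ z) z :=
  ((Trivialization.contMDiffAt_iff
    ((Trivialization.mem_source _).2 (mem_baseSet_trivializationAt_dual.2 hz))).1 contMDiffAt_id).2

end DualComponents

section TangentComponents

variable {W H : Type*} [NormedAddCommGroup W] [NormedSpace ℝ W] [TopologicalSpace H]
  {I : ModelWithCorners ℝ W H} {Q : Type*} [TopologicalSpace Q] [ChartedSpace H Q]
  [IsManifold I 1 Q]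

/-- The components of a tangent vector in the preferred chart at `q₀`. -/
def vectorComponents (q₀ : Q) (u : TangentBundle I Q) : W :=
  (trivializationAt W (TangentSpace I) q₀ u).2

theorem mem_baseSet_trivializationAt_tangent {q₀ q : Q} :
    q ∈ (trivializationAt W (TangentSpace I) q₀).baseSet ↔ q ∈ (chartAt H q₀).source := by
  rw [TangentBundle.trivializationAt_baseSet]

theorem vectorComponents_eq_mfderiv_extChartAt {q₀ : Q} {u : TangentBundle I Q}
    (hq : u.proj ∈ (chartAt H q₀).source) :
    vectorComponents q₀ u = mfderiv I 𝓘(ℝ, W) (extChartAt I q₀) u.proj u.snd :=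
  (trivializationAt_snd_eq_continuousLinearMapAt (mem_baseSet_trivializationAt_tangent.2 hq)).trans
    (DFunLike.congr_fun (TangentBundle.continuousLinearMapAt_trivializationAt hq) u.snd)

theorem vectorComponents_self (u : TangentBundle I Q) :
    vectorComponents u.proj u = u.snd := by
  rw [vectorComponents_eq_mfderiv_extChartAt (mem_chart_source H u.proj), mfderiv_extChartAt_self]
  rfl

theorem dualComponents_self (ψ : Cotangent I Q) : dualComponents ψ.proj ψ = ψ.snd := by
  have hid : (trivializationAt W (TangentSpace I) ψ.proj).continuousLinearMapAt ℝ ψ.proj =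
      ContinuousLinearMap.id ℝ W :=
    (TangentBundle.continuousLinearMapAt_trivializationAt (mem_chart_source H ψ.proj)).trans
      mfderiv_extChartAt_self
  have hb := mem_baseSet_trivializationAt W (TangentSpace I) ψ.proj
  ext w
  exact (congrArg _ (DFunLike.congr_fun hid w)).symm.trans
    (dualComponents_continuousLinearMapAt (z := ψ) hb w)

variable [I.Boundaryless]

theorem tangentLift_eq_chartDeriv {f : Q → ℝ} {q₀ : Q} {u : TangentBundle I Q}
    (hq : u.proj ∈ (chartAt H q₀).source) (hf : MDifferentiableAt I 𝓘(ℝ, ℝ) f u.proj) :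
    tangentLift I f u = chartDeriv I f q₀ u.proj (vectorComponents q₀ u) := by
  rw [vectorComponents_eq_mfderiv_extChartAt hq]
  exact mfderiv_apply_eq_chartDeriv hq hf _

theorem dualComponents_differential {f : Q → ℝ} {q₀ q : Q} (hq : q ∈ (chartAt H q₀).source)
    (hf : MDifferentiableAt I 𝓘(ℝ, ℝ) f q) :
    dualComponents q₀ (differential I f q) = chartDeriv I f q₀ q := by
  have hb := mem_baseSet_trivializationAt_tangent (I := I).2 hq
  ext w
  rw [dualComponents_apply]
  refine (tangentLift_eq_chartDeriv (u := ⟨q, _⟩) hq hf).trans (congrArg _ ?_)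
  rw [vectorComponents, trivializationAt_snd_eq_continuousLinearMapAt hb]
  exact Trivialization.continuousLinearMapAt_symmL _ hb w

end TangentComponents

section BundleComponents

variable {W H : Type*} [NormedAddCommGroup W] [NormedSpace ℝ W] [TopologicalSpace H]
  {I : ModelWithCorners ℝ W H} [I.Boundaryless] {Q : Type*} [TopologicalSpace Q] [ChartedSpace H Q]
  [IsManifold I 1 Q] {F : Type*} [NormedAddCommGroup F] [NormedSpace ℝ F]
  {E : Q → Type*} [∀ x, TopologicalSpace (E x)] [TopologicalSpace (TotalSpace F E)]
  [FiberBundle F E]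

theorem chartDeriv_comp_totalSpace_proj {G : Type*} [NormedAddCommGroup G] [NormedSpace ℝ G]
    {f : Q → G} {v₀ v : TotalSpace F E} (hv : v ∈ (chartAt (ModelProd H F) v₀).source)
    (hf : MDifferentiableAt I 𝓘(ℝ, G) f v.proj) :
    chartDeriv (I.prod 𝓘(ℝ, F)) (fun v : TotalSpace F E => f v.proj) v₀ v =
      (chartDeriv I f v₀.proj v.proj).comp (ContinuousLinearMap.fst ℝ W F) := by
  have hproj := (mem_chartAt_totalSpace_source.1 hv).2
  refine chartDeriv_eq_of_eventually (g := fun p : W × F => f ((extChartAt I v₀.proj).symm p.1)) hv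
    ?_ ?_
  · filter_upwards [(chartAt (ModelProd H F) v₀).open_source.mem_nhds hv] with v' hv'
    obtain ⟨hb', hc'⟩ := mem_chartAt_totalSpace_source.1 hv'
    rw [extChartAt_totalSpace_apply hb', extChartAt_symm_extChartAt hc']
  · rw [extChartAt_totalSpace_apply (mem_chartAt_totalSpace_source.1 hv).1]
    exact HasFDerivAt.comp (f := Prod.fst) (extChartAt I v₀.proj v.proj, _)
      (hasFDerivAt_comp_extChartAt_symm hproj hf) hasFDerivAt_fst

theorem vectorComponents_totalSpace_fst [IsManifold (I.prod 𝓘(ℝ, F)) 1 (TotalSpace F E)]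
    {v₀ : TotalSpace F E} {u : TangentBundle (I.prod 𝓘(ℝ, F)) (TotalSpace F E)}
    (hu : u.proj ∈ (chartAt (ModelProd H F) v₀).source) :
    (vectorComponents v₀ u).1 = vectorComponents v₀.proj
      (tangentMap (I.prod 𝓘(ℝ, F)) I (fun v : TotalSpace F E => v.proj) u) := by
  have hproj := (mem_chartAt_totalSpace_source.1 hu).2
  have hπ := (hasMFDerivAt_totalSpace_proj (I := I) u.proj).mdifferentiableAt
  have hext : MDifferentiableAt I 𝓘(ℝ, W) (extChartAt I v₀.proj) u.proj.proj :=
    mdifferentiableAt_extChartAt hproj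
  have hderiv : chartDeriv I (extChartAt I v₀.proj) v₀.proj u.proj.proj =
      ContinuousLinearMap.id ℝ W :=
    chartDeriv_eq_of_eventually hproj (g := id) (Eventually.of_forall fun _ => rfl)
      (hasFDerivAt_id _)
  have hcomp := mfderiv_apply_eq_chartDeriv hu (hext.comp u.proj hπ) u.snd
  rw [mfderiv_comp u.proj hext hπ] at hcomp
  rw [vectorComponents_eq_mfderiv_extChartAt hu, vectorComponents_eq_mfderiv_extChartAt hproj]
  refine (hcomp.trans ?_).symm
  rw [show chartDeriv _ (_ ∘ _) _ _ = _ from chartDeriv_comp_totalSpace_proj hu hext, hderiv]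
  rfl

end BundleComponents

section Cutoff

variable {B : Type*} [NormedAddCommGroup B] [NormedSpace ℝ B] [FiniteDimensional ℝ B]
  {M : Type*} [TopologicalSpace M] [ChartedSpace B M] [T2Space M]
  (F : Type*) [NormedAddCommGroup F] (E : M → Type*) [∀ x, TopologicalSpace (E x)]
  [TopologicalSpace (TotalSpace F E)] [FiberBundle F E]

theorem exists_cutoff (x₀ : M) : ∃ χ : SmoothBumpFunction 𝓘(ℝ, B) x₀,
    tsupport χ ⊆ (trivializationAt F E x₀).baseSet := by
  obtain ⟨χ, -, hχ⟩ := (SmoothBumpFunction.nhds_basis_tsupport (I := 𝓘(ℝ, B)) x₀).mem_iff.1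
    ((trivializationAt F E x₀).open_baseSet.mem_nhds (mem_baseSet_trivializationAt F E x₀))
  exact ⟨χ, hχ⟩

/-- A smooth bump function at `x₀` supported in the domains of the preferred chart and of the
preferred trivialization at `x₀`. -/
def cutoff (x₀ : M) : SmoothBumpFunction 𝓘(ℝ, B) x₀ := (exists_cutoff F E x₀).choose

theorem tsupport_cutoff_subset (x₀ : M) :
    tsupport (cutoff (B := B) F E x₀) ⊆ (trivializationAt F E x₀).baseSet :=
  (exists_cutoff F E x₀).choose_spec

/-- The points at which the cutoff function at `x₀` is locally equal to `1`, in the domains of the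
preferred chart and of the preferred trivialization at `x₀`. -/
structure IsCutoffPoint (x₀ x : M) : Prop where
  cutoff_eq_one : ∀ᶠ x' in 𝓝 x, cutoff (B := B) F E x₀ x' = 1
  mem_baseSet : x ∈ (trivializationAt F E x₀).baseSet
  mem_source : x ∈ (chartAt B x₀).source

theorem isCutoffPoint_self (x₀ : M) : IsCutoffPoint (B := B) F E x₀ x₀ :=
  ⟨(cutoff F E x₀).eventuallyEq_one, mem_baseSet_trivializationAt F E x₀, mem_chart_source B x₀⟩

variable {F E} in
theorem IsCutoffPoint.eventually {x₀ x : M} (hx : IsCutoffPoint (B := B) F E x₀ x) :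
    ∀ᶠ x' in 𝓝 x, IsCutoffPoint (B := B) F E x₀ x' := by
  filter_upwards [hx.cutoff_eq_one.eventually_nhds,
    (trivializationAt F E x₀).open_baseSet.mem_nhds hx.mem_baseSet,
    (chartAt B x₀).open_source.mem_nhds hx.mem_source] with x' hone hbase hsource
  exact ⟨hone, hbase, hsource⟩

/-- The product of the cutoff function at `x₀` with the coordinate expression `p` of a function. -/
def cutoffLinear (x₀ : M) (p : B →L[ℝ] ℝ) (x : M) : ℝ :=
  cutoff (B := B) F E x₀ x • p (extChartAt 𝓘(ℝ, B) x₀ x)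

theorem IsCutoffPoint.chartDeriv_cutoffLinear {x₀ x : M} (hx : IsCutoffPoint (B := B) F E x₀ x)
    (p : B →L[ℝ] ℝ) : chartDeriv 𝓘(ℝ, B) (cutoffLinear F E x₀ p) x₀ x = p := by
  refine chartDeriv_eq_of_eventually hx.mem_source ?_ p.hasFDerivAt
  filter_upwards [hx.cutoff_eq_one] with x' hx'
  rw [cutoffLinear, hx', one_smul]

variable [IsManifold 𝓘(ℝ, B) ∞ M]

theorem contMDiff_cutoffLinear (x₀ : M) (p : B →L[ℝ] ℝ) :
    ContMDiff 𝓘(ℝ, B) 𝓘(ℝ, ℝ) ∞ (cutoffLinear F E x₀ p) :=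
  SmoothBumpFunction.contMDiff_smul _
    (p.contDiff.contMDiff.comp_contMDiffOn contMDiffOn_extChartAt)

theorem contMDiff_cutoff_smul {G : Type*} [NormedAddCommGroup G] [NormedSpace ℝ G] (x₀ : M)
    {g : M → G} (hg : ContMDiffOn 𝓘(ℝ, B) 𝓘(ℝ, G) ∞ g (trivializationAt F E x₀).baseSet) :
    ContMDiff 𝓘(ℝ, B) 𝓘(ℝ, G) ∞ fun x => cutoff (B := B) F E x₀ x • g x := by
  refine contMDiff_of_tsupport fun x hx => ?_
  have hxb := tsupport_cutoff_subset F E x₀ (tsupport_smul_subset_left _ _ hx)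
  exact (cutoff F E x₀).contMDiffAt.smul
    (hg.contMDiffAt ((trivializationAt F E x₀).open_baseSet.mem_nhds hxb))

end Cutoff

section Components

variable {B : Type*} [NormedAddCommGroup B] [NormedSpace ℝ B]
  {M : Type*} [TopologicalSpace M] [ChartedSpace B M]
  {F : Type*} [NormedAddCommGroup F] [NormedSpace ℝ F]
  {E : M → Type*} [∀ x, AddCommGroup (E x)] [∀ x, Module ℝ (E x)] [∀ x, TopologicalSpace (E x)]
  [TopologicalSpace (TotalSpace F E)] [FiberBundle F E] [VectorBundle ℝ F E]

/-- The evaluation of the sections of `E` at a point. -/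
def evalSection (x : M) : ContMDiffSection 𝓘(ℝ, B) F ∞ E →ₗ[ℝ] E x where
  toFun X := X x
  map_add' _ _ := rfl
  map_smul' _ _ := rfl

/-- The components of a section in the preferred trivialization at `x₀`. -/
def components (x₀ : M) (X : ContMDiffSection 𝓘(ℝ, B) F ∞ E) (x : M) : F :=
  (trivializationAt F E x₀).continuousLinearMapAt ℝ x (X x)

theorem symmL_components {x₀ x : M} (hx : x ∈ (trivializationAt F E x₀).baseSet)
    (X : ContMDiffSection 𝓘(ℝ, B) F ∞ E) :
    (trivializationAt F E x₀).symmL ℝ x (components x₀ X x) = X x :=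
  Trivialization.symmL_continuousLinearMapAt _ hx _

variable [ContMDiffVectorBundle ∞ F E 𝓘(ℝ, B)]

theorem contMDiffOn_components (x₀ : M) (X : ContMDiffSection 𝓘(ℝ, B) F ∞ E) :
    ContMDiffOn 𝓘(ℝ, B) 𝓘(ℝ, F) ∞ (components x₀ X) (trivializationAt F E x₀).baseSet := by
  refine ((trivializationAt F E x₀).contMDiffOn_section_baseSet_iff.1
    X.contMDiff.contMDiffOn).congr fun x hx => ?_
  exact congrFun (Trivialization.coe_linearMapAt_of_mem _ hx) _

theorem contMDiffAt_components {x₀ x : M} (hx : x ∈ (trivializationAt F E x₀).baseSet)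
    (X : ContMDiffSection 𝓘(ℝ, B) F ∞ E) :
    ContMDiffAt 𝓘(ℝ, B) 𝓘(ℝ, F) ∞ (components x₀ X) x :=
  (contMDiffOn_components x₀ X).contMDiffAt ((trivializationAt F E x₀).open_baseSet.mem_nhds hx)

theorem mdifferentiableAt_components {x₀ x : M} (hx : x ∈ (trivializationAt F E x₀).baseSet)
    (X : ContMDiffSection 𝓘(ℝ, B) F ∞ E) :
    MDifferentiableAt 𝓘(ℝ, B) 𝓘(ℝ, F) (components x₀ X) x :=
  (contMDiffAt_components hx X).mdifferentiableAt (by simp)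

variable [IsManifold 𝓘(ℝ, B) ∞ M] [FiniteDimensional ℝ B] [T2Space M]

/-- The global sections which, near `x₀`, are constant in the preferred trivialization at `x₀`. -/
def frame (x₀ : M) : F →ₗ[ℝ] ContMDiffSection 𝓘(ℝ, B) F ∞ E where
  toFun y := ⟨fun x => cutoff (B := B) F E x₀ x • (trivializationAt F E x₀).symmL ℝ x y, by
    refine ContMDiffOn.smul_section_of_tsupport (cutoff F E x₀).contMDiff.contMDiffOn
      (trivializationAt F E x₀).open_baseSet (tsupport_cutoff_subset F E x₀) ?_
    rw [(trivializationAt F E x₀).contMDiffOn_section_baseSet_iff]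
    refine (contMDiffOn_const (c := y)).congr fun x hx => ?_
    rw [Trivialization.symmL_apply _ hx, Trivialization.apply_mk_symm _ hx]⟩
  map_add' y y' := by
    ext x
    simp
  map_smul' c y := by
    ext x
    simp [smul_comm c]

theorem IsCutoffPoint.frame_apply {x₀ x : M} (hx : IsCutoffPoint (B := B) F E x₀ x) (y : F) :
    frame (B := B) (E := E) x₀ y x = (trivializationAt F E x₀).symmL ℝ x y := by
  change cutoff (B := B) F E x₀ x • (trivializationAt F E x₀).symmL ℝ x y = _
  rw [hx.cutoff_eq_one.self_of_nhds, one_smul]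

theorem frame_components_self (x : M) (X : ContMDiffSection 𝓘(ℝ, B) F ∞ E) :
    frame (B := B) (E := E) x (components x X x) x = X x := by
  rw [(isCutoffPoint_self F E x).frame_apply,
    symmL_components (mem_baseSet_trivializationAt F E x)]

theorem IsCutoffPoint.components_frame {x₀ x : M} (hx : IsCutoffPoint (B := B) F E x₀ x) (y : F) :
    components x₀ (frame (B := B) (E := E) x₀ y) x = y := by
  rw [components, hx.frame_apply, Trivialization.continuousLinearMapAt_symmL _ hx.mem_baseSet]

theorem IsCutoffPoint.chartDeriv_components_frame {x₀ x : M}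
    (hx : IsCutoffPoint (B := B) F E x₀ x) (y : F) :
    chartDeriv 𝓘(ℝ, B) (components x₀ (frame (B := B) (E := E) x₀ y)) x₀ x = 0 := by
  have hconst : components x₀ (frame (B := B) (E := E) x₀ y) =ᶠ[𝓝 x] fun _ => y := by
    filter_upwards [hx.eventually] with x' hx'
    exact hx'.components_frame y
  rw [chartDeriv_congr hx.mem_source hconst, chartDeriv_const]

end Components

section LinearFunctions

open SkewAlgebroid

variable {B : Type*} [NormedAddCommGroup B] [NormedSpace ℝ B]
  {M : Type*} [TopologicalSpace M] [ChartedSpace B M]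
  {F : Type*} [NormedAddCommGroup F] [NormedSpace ℝ F]
  {E : M → Type*} [∀ x, AddCommGroup (E x)] [∀ x, Module ℝ (E x)] [∀ x, TopologicalSpace (E x)]
  [TopologicalSpace (TotalSpace F E)] [FiberBundle F E] [VectorBundle ℝ F E]

theorem linearFunction_eq {x₀ : M} {z : DualBundle F E}
    (hz : z.proj ∈ (trivializationAt F E x₀).baseSet) (X : ContMDiffSection 𝓘(ℝ, B) F ∞ E) :
    linearFunction X z = dualComponents x₀ z (components x₀ X z.proj) :=
  (dualComponents_continuousLinearMapAt hz _).symm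

variable [ContMDiffVectorBundle ∞ F E 𝓘(ℝ, B)] [IsManifold 𝓘(ℝ, B) ∞ M]

theorem contMDiff_linearFunction (X : ContMDiffSection 𝓘(ℝ, B) F ∞ E) :
    ContMDiff (modelDual B F) 𝓘(ℝ, ℝ) ∞ (linearFunction X : DualBundle F E → ℝ) := by
  intro z
  have hz := mem_baseSet_trivializationAt F E z.proj
  refine ((contMDiffAt_dualComponents hz).clm_apply
    ((contMDiffAt_components hz X).comp z (contMDiffAt_proj _))).congr_of_eventuallyEq ?_
  filter_upwards [(FiberBundle.continuous_proj (F →L[ℝ] ℝ) _).continuousAt.eventually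
    ((trivializationAt F E z.proj).open_baseSet.mem_nhds hz)] with z' hz'
  exact linearFunction_eq hz' X

theorem chartDeriv_linearFunction {z₀ z : DualBundle F E}
    (hz : z ∈ (chartAt (ModelProd B (F →L[ℝ] ℝ)) z₀).source)
    (X : ContMDiffSection 𝓘(ℝ, B) F ∞ E) (w : B × (F →L[ℝ] ℝ)) :
    chartDeriv (modelDual B F) (linearFunction X) z₀ z w =
      dualComponents z₀.proj z (chartDeriv 𝓘(ℝ, B) (components z₀.proj X) z₀.proj z.proj w.1) +
        w.2 (components z₀.proj X z.proj) := by
  obtain ⟨hb, hc⟩ := mem_chartAt_dual_source.1 hz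
  have hX := HasFDerivAt.comp (f := Prod.fst)
    (extChartAt 𝓘(ℝ, B) z₀.proj z.proj, dualComponents z₀.proj z)
    (hasFDerivAt_comp_extChartAt_symm hc (mdifferentiableAt_components hb X)) hasFDerivAt_fst
  have hXz : (components z₀.proj X ∘ (extChartAt 𝓘(ℝ, B) z₀.proj).symm)
      (extChartAt 𝓘(ℝ, B) z₀.proj z.proj) = components z₀.proj X z.proj :=
    congrArg _ (extChartAt_symm_extChartAt hc)
  rw [chartDeriv_eq_of_eventually hz (g := fun p => p.2 ((components z₀.proj X ∘
    (extChartAt 𝓘(ℝ, B) z₀.proj).symm) p.1)) ?_ (by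
      rw [extChartAt_dual_apply hb]
      exact hasFDerivAt_snd.clm_apply hX), ← hXz]
  · simp [add_comm]
  · filter_upwards [(chartAt (ModelProd B (F →L[ℝ] ℝ)) z₀).open_source.mem_nhds hz] with z' hz'
    obtain ⟨hb', hc'⟩ := mem_chartAt_dual_source.1 hz'
    rw [extChartAt_dual_apply hb', linearFunction_eq hb', Function.comp_apply,
      extChartAt_symm_extChartAt hc']

theorem dualComponents_differential_linearFunction_add {z₀ z : DualBundle F E}
    (hz : z ∈ (chartAt (ModelProd B (F →L[ℝ] ℝ)) z₀).source)
    (X : ContMDiffSection 𝓘(ℝ, B) F ∞ E) {f : M → ℝ}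
    (hf : MDifferentiableAt 𝓘(ℝ, B) 𝓘(ℝ, ℝ) f z.proj) (w : B × (F →L[ℝ] ℝ)) :
    dualComponents z₀ (differential (modelDual B F)
        (fun z : DualBundle F E => linearFunction X z + f z.proj) z) w =
      dualComponents z₀.proj z (chartDeriv 𝓘(ℝ, B) (components z₀.proj X) z₀.proj z.proj w.1) +
        w.2 (components z₀.proj X z.proj) + chartDeriv 𝓘(ℝ, B) f z₀.proj z.proj w.1 := by
  have hX : MDifferentiableAt (modelDual B F) 𝓘(ℝ, ℝ) (linearFunction X) z :=
    (contMDiff_linearFunction X).mdifferentiableAt (by simp)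
  have hfπ : MDifferentiableAt (modelDual B F) 𝓘(ℝ, ℝ) (fun z : DualBundle F E => f z.proj) z :=
    hf.comp z (mdifferentiableAt_proj _)
  refine (congrArg (fun a : B × (F →L[ℝ] ℝ) →L[ℝ] ℝ => a w)
    ((dualComponents_differential hz (hX.add hfπ)).trans (chartDeriv_add hz hX hfπ))).trans ?_
  rw [chartDeriv_comp_totalSpace_proj hz hf, ← chartDeriv_linearFunction hz X w]
  rfl

theorem IsCutoffPoint.chartDeriv_linearFunction_frame [FiniteDimensional ℝ B] [T2Space M]
    {z₀ z : DualBundle F E}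
    (hz : IsCutoffPoint (B := B) F E z₀.proj z.proj) (y : F) (w : B × (F →L[ℝ] ℝ)) :
    chartDeriv (modelDual B F) (linearFunction (frame (B := B) (E := E) z₀.proj y)) z₀ z w =
      w.2 y := by
  rw [chartDeriv_linearFunction (mem_chartAt_dual_source.2 ⟨hz.mem_baseSet, hz.mem_source⟩),
    hz.chartDeriv_components_frame, hz.components_frame, zero_apply, map_zero, zero_add]

end LinearFunctions

section LocalExpansion

variable {B : Type*} [NormedAddCommGroup B] [NormedSpace ℝ B] [FiniteDimensional ℝ B]
  {M : Type*} [TopologicalSpace M] [ChartedSpace B M] [T2Space M]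
  {F : Type*} [NormedAddCommGroup F] [NormedSpace ℝ F]
  {E : M → Type*} [∀ x, AddCommGroup (E x)] [∀ x, Module ℝ (E x)] [∀ x, TopologicalSpace (E x)]
  [TopologicalSpace (TotalSpace F E)] [FiberBundle F E] [VectorBundle ℝ F E]

/-- The product of the cutoff function at `x₀` with the function `ℓ ∘ Y`, for the components of `Y`
in the preferred trivialization at `x₀`. -/
def cutoffCoord (x₀ : M) (Y : ContMDiffSection 𝓘(ℝ, B) F ∞ E) (ℓ : F →L[ℝ] ℝ) (x : M) : ℝ :=
  cutoff (B := B) F E x₀ x • ℓ (components x₀ Y x)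

theorem IsCutoffPoint.cutoffCoord_eq {x₀ x : M} (hx : IsCutoffPoint (B := B) F E x₀ x)
    (Y : ContMDiffSection 𝓘(ℝ, B) F ∞ E) (ℓ : F →L[ℝ] ℝ) :
    cutoffCoord x₀ Y ℓ x = ℓ (components x₀ Y x) := by
  rw [cutoffCoord, hx.cutoff_eq_one.self_of_nhds, one_smul]

variable [IsManifold 𝓘(ℝ, B) ∞ M] [ContMDiffVectorBundle ∞ F E 𝓘(ℝ, B)]

theorem contMDiff_cutoffCoord (x₀ : M) (Y : ContMDiffSection 𝓘(ℝ, B) F ∞ E) (ℓ : F →L[ℝ] ℝ) :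
    ContMDiff 𝓘(ℝ, B) 𝓘(ℝ, ℝ) ∞ (cutoffCoord x₀ Y ℓ) :=
  contMDiff_cutoff_smul F E x₀
    (ℓ.contDiff.contMDiff.comp_contMDiffOn (contMDiffOn_components x₀ Y))

theorem IsCutoffPoint.chartDeriv_cutoffCoord {x₀ x : M} (hx : IsCutoffPoint (B := B) F E x₀ x)
    (Y : ContMDiffSection 𝓘(ℝ, B) F ∞ E) (ℓ : F →L[ℝ] ℝ) :
    chartDeriv 𝓘(ℝ, B) (cutoffCoord x₀ Y ℓ) x₀ x =
      ℓ.comp (chartDeriv 𝓘(ℝ, B) (components x₀ Y) x₀ x) := by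
  rw [chartDeriv_congr hx.mem_source (hx.eventually.mono fun x' hx' => hx'.cutoffCoord_eq Y ℓ),
    chartDeriv_clm_comp _ hx.mem_source (mdifferentiableAt_components hx.mem_baseSet Y)]

/-- The term along `y` in the expansion of `Y` in the frame at `x₀`, when `ℓ` is the coordinate dual
to `y`; the cutoff makes it a global section. -/
def cutoffCoordSMulFrame (x₀ : M) (Y : ContMDiffSection 𝓘(ℝ, B) F ∞ E) (ℓ : F →L[ℝ] ℝ) (y : F) :
    ContMDiffSection 𝓘(ℝ, B) F ∞ E :=
  ⟨fun x => cutoffCoord x₀ Y ℓ x • frame (B := B) (E := E) x₀ y x,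
    (contMDiff_cutoffCoord x₀ Y ℓ).smul_section (frame x₀ y).contMDiff⟩

theorem IsCutoffPoint.sum_cutoffCoordSMulFrame {x₀ x : M} (hx : IsCutoffPoint (B := B) F E x₀ x)
    {ι : Type*} [Fintype ι] (b : Module.Basis ι ℝ F) {c : ι → F →L[ℝ] ℝ}
    (hc : ∀ i y, c i y = b.repr y i) (Y : ContMDiffSection 𝓘(ℝ, B) F ∞ E) :
    (∑ i, cutoffCoordSMulFrame x₀ Y (c i) (b i)) x = Y x := by
  have hterm (i) : cutoffCoordSMulFrame x₀ Y (c i) (b i) x =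
      (trivializationAt F E x₀).symmL ℝ x (b.repr (components x₀ Y x) i • b i) := by
    rw [map_smul, ← hx.frame_apply, ← hc, ← hx.cutoffCoord_eq]
    rfl
  refine (map_sum (evalSection x) _ _).trans ?_
  rw [← symmL_components hx.mem_baseSet Y, ← b.sum_repr (components x₀ Y x), map_sum]
  exact Finset.sum_congr rfl fun i _ => hterm i

end LocalExpansion

namespace SkewAlgebroid

section Bracket

variable {B : Type*} [NormedAddCommGroup B] [NormedSpace ℝ B]
  {M : Type*} [TopologicalSpace M] [ChartedSpace B M] [IsManifold 𝓘(ℝ, B) ∞ M]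
  {F : Type*} [NormedAddCommGroup F] [NormedSpace ℝ F]
  {E : M → Type*} [∀ x, AddCommGroup (E x)] [∀ x, Module ℝ (E x)] [∀ x, TopologicalSpace (E x)]
  [TopologicalSpace (TotalSpace F E)] [FiberBundle F E] [VectorBundle ℝ F E]
  (𝔸 : SkewAlgebroid (B := B) F E) [FiniteDimensional ℝ B] [T2Space M]

theorem bracket_apply_eq_zero (X : ContMDiffSection 𝓘(ℝ, B) F ∞ E)
    {Y : ContMDiffSection 𝓘(ℝ, B) F ∞ E} {x : M} (hY : ∀ᶠ x' in 𝓝 x, Y x' = 0) :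
    𝔸.bracket X Y x = 0 := by
  obtain ⟨χ, -, hχ⟩ := (SmoothBumpFunction.nhds_basis_tsupport (I := 𝓘(ℝ, B)) x).mem_iff.1 hY
  have hχY : ∀ x', (0 : ContMDiffSection 𝓘(ℝ, B) F ∞ E) x' = χ x' • Y x' := fun x' => by
    by_cases hx' : x' ∈ tsupport χ
    · rw [show Y x' = 0 from hχ hx', smul_zero]
      rfl
    · rw [image_eq_zero_of_notMem_tsupport hx', zero_smul]
      rfl
  have hleibniz := 𝔸.leibniz X Y 0 χ χ.contMDiff hχY x
  rw [map_zero, χ.eq_one, one_smul, hY.self_of_nhds, smul_zero, add_zero] at hleibniz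
  exact hleibniz.symm

theorem bracket_congr (X : ContMDiffSection 𝓘(ℝ, B) F ∞ E)
    {Y Y' : ContMDiffSection 𝓘(ℝ, B) F ∞ E} {x : M} (h : ∀ᶠ x' in 𝓝 x, Y x' = Y' x') :
    𝔸.bracket X Y x = 𝔸.bracket X Y' x := by
  have hsub := 𝔸.bracket_apply_eq_zero X (Y := Y - Y') (h.mono fun x' hx' => sub_eq_zero.2 hx')
  rw [map_sub] at hsub
  exact sub_eq_zero.1 hsub

variable [ContMDiffVectorBundle ∞ F E 𝓘(ℝ, B)]

theorem bracket_cutoffCoordSMulFrame (X Y : ContMDiffSection 𝓘(ℝ, B) F ∞ E) (ℓ : F →L[ℝ] ℝ) (y : F)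
    (x : M) :
    𝔸.bracket X (cutoffCoordSMulFrame x Y ℓ y) x =
      ℓ (components x Y x) • 𝔸.bracket X (frame x y) x +
        ℓ (chartDeriv 𝓘(ℝ, B) (components x Y) x x (𝔸.anchor x (X x))) •
          frame (B := B) (E := E) x y x := by
  have hx := isCutoffPoint_self (B := B) F E x
  have hℓ := contMDiff_cutoffCoord x Y ℓ
  rw [𝔸.leibniz X (frame x y) _ _ hℓ (fun _ => rfl), hx.cutoffCoord_eq,
    tangentLift, mfderiv_eq_chartDeriv (hℓ.mdifferentiableAt (by simp)), hx.chartDeriv_cutoffCoord]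
  rfl

theorem bracket_eq_frame_right [FiniteDimensional ℝ F] (X Y : ContMDiffSection 𝓘(ℝ, B) F ∞ E)
    (x : M) :
    𝔸.bracket X Y x = 𝔸.bracket X (frame x (components x Y x)) x +
      frame (B := B) (E := E) x
        (chartDeriv 𝓘(ℝ, B) (components x Y) x x (𝔸.anchor x (X x))) x := by
  let b := Module.finBasis ℝ F
  let c (i) : F →L[ℝ] ℝ := (b.coord i).toContinuousLinearMap
  have hsum (T : F →ₗ[ℝ] E x) (y : F) : ∑ i, c i y • T (b i) = T y := by
    conv_rhs => rw [← b.sum_repr y, map_sum]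
    exact Finset.sum_congr rfl fun i _ => (map_smul T _ _).symm
  rw [𝔸.bracket_congr X ((isCutoffPoint_self F E x).eventually.mono fun x' hx' =>
    (hx'.sum_cutoffCoordSMulFrame b (c := c) (fun _ _ => rfl) Y).symm), map_sum]
  refine (map_sum (evalSection x) _ _).trans ((Finset.sum_congr rfl fun i _ =>
    𝔸.bracket_cutoffCoordSMulFrame X Y (c i) (b i) x).trans ?_)
  rw [Finset.sum_add_distrib]
  exact congrArg₂ _ (hsum (evalSection x ∘ₗ 𝔸.bracket X ∘ₗ frame x) _)
    (hsum (evalSection x ∘ₗ frame x) _)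

theorem bracket_eq_frame [FiniteDimensional ℝ F] (X Y : ContMDiffSection 𝓘(ℝ, B) F ∞ E) (x : M) :
    𝔸.bracket X Y x = 𝔸.bracket (frame x (components x X x)) (frame x (components x Y x)) x +
      frame (B := B) (E := E) x
        (chartDeriv 𝓘(ℝ, B) (components x Y) x x (𝔸.anchor x (X x))) x -
      frame (B := B) (E := E) x
        (chartDeriv 𝓘(ℝ, B) (components x X) x x (𝔸.anchor x (Y x))) x := by
  have hskew (X Y) : 𝔸.bracket X Y x = -𝔸.bracket Y X x :=
    congrArg (evalSection x) (𝔸.skew X Y)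
  rw [bracket_eq_frame_right, hskew X, bracket_eq_frame_right,
    hskew (frame x (components x Y x)), frame_components_self]
  abel

end Bracket

end SkewAlgebroid

section FibrePart

variable {G F : Type*} [NormedAddCommGroup G] [NormedSpace ℝ G] [NormedAddCommGroup F]
  [NormedSpace ℝ F] [FiniteDimensional ℝ F]

/-- The component in `F`, identified with its double dual, of a linear form on `G × F*`. -/
def fibrePart (a : G × (F →L[ℝ] ℝ) →L[ℝ] ℝ) : F :=
  (Module.evalEquiv ℝ F).symm (a.toLinearMap ∘ₗ LinearMap.inr ℝ G (F →L[ℝ] ℝ) ∘ₗ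
    LinearMap.toContinuousLinearMap.toLinearMap)

theorem apply_fibrePart (a : G × (F →L[ℝ] ℝ) →L[ℝ] ℝ) (δ : F →L[ℝ] ℝ) :
    δ (fibrePart a) = a (0, δ) :=
  Module.apply_evalEquiv_symm_apply ℝ F (δ : Module.Dual ℝ F) _

theorem fibrePart_eq_iff {a : G × (F →L[ℝ] ℝ) →L[ℝ] ℝ} {y : F} :
    fibrePart a = y ↔ ∀ δ : F →L[ℝ] ℝ, a (0, δ) = δ y := by
  simp only [← apply_fibrePart]
  exact SeparatingDual.eq_iff_forall_dual_eq (R := ℝ)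

end FibrePart

namespace SkewAlgebroid

section Contraction

variable {B : Type*} [NormedAddCommGroup B] [NormedSpace ℝ B]
  {M : Type*} [TopologicalSpace M] [ChartedSpace B M] [IsManifold 𝓘(ℝ, B) ∞ M]
  {F : Type*} [NormedAddCommGroup F] [NormedSpace ℝ F]
  {E : M → Type*} [∀ x, AddCommGroup (E x)] [∀ x, Module ℝ (E x)] [∀ x, TopologicalSpace (E x)]
  [TopologicalSpace (TotalSpace F E)] [FiberBundle F E] [VectorBundle ℝ F E]
  (𝔸 : SkewAlgebroid (B := B) F E)

/-- The anchor in the preferred trivializations of `E` and `TM` at `x₀`. -/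
def anchorComponents (x₀ x : M) : F →L[ℝ] B :=
  (trivializationAt B (TangentSpace 𝓘(ℝ, B)) x₀).continuousLinearMapAt ℝ x ∘L 𝔸.anchor x ∘L
    (trivializationAt F E x₀).symmL ℝ x

theorem anchorComponents_components {x₀ x : M} (hx : x ∈ (trivializationAt F E x₀).baseSet)
    (hx' : x ∈ (chartAt B x₀).source) (X : ContMDiffSection 𝓘(ℝ, B) F ∞ E) :
    𝔸.anchorComponents x₀ x (components x₀ X x) =
      vectorComponents x₀ (⟨x, 𝔸.anchor x (X x)⟩ : TangentBundle 𝓘(ℝ, B) M) := by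
  rw [vectorComponents, trivializationAt_snd_eq_continuousLinearMapAt
    (mem_baseSet_trivializationAt_tangent.2 hx'), ← symmL_components hx X]
  rfl

theorem tangentLift_anchor {x₀ x : M} (hx : x ∈ (trivializationAt F E x₀).baseSet)
    (hx' : x ∈ (chartAt B x₀).source) (X : ContMDiffSection 𝓘(ℝ, B) F ∞ E) {f : M → ℝ}
    (hf : MDifferentiableAt 𝓘(ℝ, B) 𝓘(ℝ, ℝ) f x) :
    tangentLift 𝓘(ℝ, B) f ⟨x, 𝔸.anchor x (X x)⟩ =
      chartDeriv 𝓘(ℝ, B) f x₀ x (𝔸.anchorComponents x₀ x (components x₀ X x)) := by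
  rw [tangentLift_eq_chartDeriv (u := ⟨x, 𝔸.anchor x (X x)⟩) hx' hf,
    anchorComponents_components 𝔸 hx hx']

theorem anchorComponents_components_self (X : ContMDiffSection 𝓘(ℝ, B) F ∞ E) (x : M) :
    𝔸.anchorComponents x x (components x X x) = 𝔸.anchor x (X x) :=
  (𝔸.anchorComponents_components (mem_baseSet_trivializationAt F E x) (mem_chart_source B x)
    X).trans (vectorComponents_self (⟨x, 𝔸.anchor x (X x)⟩ : TangentBundle 𝓘(ℝ, B) M))

variable [FiniteDimensional ℝ B] [T2Space M] [FiniteDimensional ℝ F]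
  [ContMDiffVectorBundle ∞ F E 𝓘(ℝ, B)]

/-- The pairing of `z` with the brackets of the sections of the frame at `x₀`. -/
def bracketForm (x₀ : M) (z : DualBundle F E) : F →L[ℝ] F →L[ℝ] ℝ :=
  LinearMap.toContinuousBilinearMap ((𝔸.bracket.compl₁₂ (frame x₀) (frame x₀)).compr₂
    (z.snd.toLinearMap ∘ₗ evalSection z.proj))

theorem bracketForm_apply (x₀ : M) (z : DualBundle F E) (y y' : F) :
    𝔸.bracketForm x₀ z y y' = linearFunction (𝔸.bracket (frame x₀ y) (frame x₀ y')) z := rfl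

theorem linearFunction_bracket (X Y : ContMDiffSection 𝓘(ℝ, B) F ∞ E) (z : DualBundle F E) :
    linearFunction (𝔸.bracket X Y) z =
      𝔸.bracketForm z.proj z (components z.proj X z.proj) (components z.proj Y z.proj) +
        dualComponents z.proj z (chartDeriv 𝓘(ℝ, B) (components z.proj Y) z.proj z.proj
          (𝔸.anchorComponents z.proj z.proj (components z.proj X z.proj))) -
        dualComponents z.proj z (chartDeriv 𝓘(ℝ, B) (components z.proj X) z.proj z.proj
          (𝔸.anchorComponents z.proj z.proj (components z.proj Y z.proj))) := by
  have hframe (y : F) : z.snd (frame (B := B) z.proj y z.proj) = dualComponents z.proj z y := by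
    rw [(isCutoffPoint_self F E z.proj).frame_apply, dualComponents_apply]
  rw [linearFunction, bracket_eq_frame, map_sub, map_add, hframe, hframe,
    anchorComponents_components_self, anchorComponents_components_self]
  rfl

/-- The contraction with `Π`, in induced coordinates, of the covector with components `a` at `z`.
The components of `Π` are the coefficients of the anchor and the structure functions of the
bracket. -/
def contraction (x₀ : M) (z : DualBundle F E) (a : B × (F →L[ℝ] ℝ) →L[ℝ] ℝ) : B × (F →L[ℝ] ℝ) :=
  (𝔸.anchorComponents x₀ z.proj (fibrePart a),
    𝔸.bracketForm x₀ z (fibrePart a) -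
      (a.comp (ContinuousLinearMap.inl ℝ B (F →L[ℝ] ℝ))).comp (𝔸.anchorComponents x₀ z.proj))

theorem contraction_snd_apply (x₀ : M) (z : DualBundle F E) (a : B × (F →L[ℝ] ℝ) →L[ℝ] ℝ) (y : F) :
    (𝔸.contraction x₀ z a).2 y =
      𝔸.bracketForm x₀ z (fibrePart a) y - a (𝔸.anchorComponents x₀ z.proj y, 0) := rfl

theorem isContraction_contraction (ψ : Cotangent (modelDual B F) (DualBundle F E)) :
    𝔸.IsContraction ψ (𝔸.contraction ψ.proj.proj ψ.proj (dualComponents ψ.proj ψ)) := by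
  intro X f hf hψ
  have hf' : MDifferentiableAt 𝓘(ℝ, B) 𝓘(ℝ, ℝ) f ψ.proj.proj := hf.mdifferentiableAt (by simp)
  have hz := mem_chart_source (ModelProd B (F →L[ℝ] ℝ)) ψ.proj
  have ⟨hbaseSet, hsource⟩ := mem_chartAt_dual_source.1 hz
  set a := dualComponents ψ.proj ψ
  have ha (w : B × (F →L[ℝ] ℝ)) : a w = dualComponents ψ.proj.proj ψ.proj
        (chartDeriv 𝓘(ℝ, B) (components ψ.proj.proj X) ψ.proj.proj ψ.proj.proj w.1) +
      w.2 (components ψ.proj.proj X ψ.proj.proj) +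
      chartDeriv 𝓘(ℝ, B) f ψ.proj.proj ψ.proj.proj w.1 := by
    rw [← dualComponents_differential_linearFunction_add hz X hf', hψ]
  have hfibre : fibrePart a = components ψ.proj.proj X ψ.proj.proj :=
    fibrePart_eq_iff.2 fun δ => by simp [ha]
  have hbase (v : B) : a (v, 0) = dualComponents ψ.proj.proj ψ.proj
        (chartDeriv 𝓘(ℝ, B) (components ψ.proj.proj X) ψ.proj.proj ψ.proj.proj v) +
      chartDeriv 𝓘(ℝ, B) f ψ.proj.proj ψ.proj.proj v := by simp [ha]
  refine ⟨?_, fun Y => ?_⟩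
  · rw [(hasMFDerivAt_totalSpace_proj ψ.proj).mfderiv, ← 𝔸.anchorComponents_components_self,
      ← hfibre]
    rfl
  · rw [𝔸.tangentLift_anchor hbaseSet hsource Y hf', linearFunction_bracket, ← hfibre, tangentLift,
      mfderiv_eq_chartDeriv ((contMDiff_linearFunction Y).mdifferentiableAt (by simp))]
    refine (chartDeriv_linearFunction hz Y (𝔸.contraction ψ.proj.proj ψ.proj a)).trans ?_
    rw [contraction_snd_apply, contraction, hbase]
    ring

theorem isContraction_sharp (ψ : Cotangent (modelDual B F) (DualBundle F E)) :
    𝔸.IsContraction ψ (𝔸.sharp ψ).snd :=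
  Classical.epsilon_spec (p := 𝔸.IsContraction ψ) ⟨_, 𝔸.isContraction_contraction ψ⟩

end Contraction

section Sharp

variable {B : Type*} [NormedAddCommGroup B] [NormedSpace ℝ B] [FiniteDimensional ℝ B]
  {M : Type*} [TopologicalSpace M] [T2Space M] [ChartedSpace B M] [IsManifold 𝓘(ℝ, B) ∞ M]
  {F : Type*} [NormedAddCommGroup F] [NormedSpace ℝ F] [FiniteDimensional ℝ F]
  {E : M → Type*} [∀ x, AddCommGroup (E x)] [∀ x, Module ℝ (E x)] [∀ x, TopologicalSpace (E x)]
  [TopologicalSpace (TotalSpace F E)] [FiberBundle F E] [VectorBundle ℝ F E]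
  [ContMDiffVectorBundle ∞ F E 𝓘(ℝ, B)]

theorem differential_frame_add_cutoffLinear {z₀ : DualBundle F E}
    {ψ : Cotangent (modelDual B F) (DualBundle F E)}
    (hψ : IsCutoffPoint (B := B) F E z₀.proj ψ.proj.proj) :
    differential (modelDual B F) (fun z : DualBundle F E =>
      linearFunction (frame (B := B) (E := E) z₀.proj
          (fibrePart (F := F) (dualComponents z₀ ψ))) z +
        cutoffLinear F E z₀.proj ((dualComponents z₀ ψ).comp
          (ContinuousLinearMap.inl ℝ B (F →L[ℝ] ℝ))) z.proj) ψ.proj = ψ := by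
  have hz := mem_chartAt_dual_source.2 ⟨hψ.mem_baseSet, hψ.mem_source⟩
  have hf := (contMDiff_cutoffLinear F E z₀.proj ((dualComponents z₀ ψ).comp
    (ContinuousLinearMap.inl ℝ B (F →L[ℝ] ℝ)))).mdifferentiableAt (x := ψ.proj.proj) (by simp)
  refine eq_of_dualComponents_eq (x₀ := z₀) rfl (mem_baseSet_trivializationAt_tangent.2 hz)
    (ContinuousLinearMap.ext fun w => ?_)
  rw [dualComponents_differential_linearFunction_add hz _ hf, hψ.chartDeriv_components_frame,
    hψ.components_frame, hψ.chartDeriv_cutoffLinear, apply_fibrePart, zero_apply, map_zero,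
    zero_add, ContinuousLinearMap.comp_apply, ← map_add]
  simp

variable (𝔸 : SkewAlgebroid (B := B) F E)

theorem vectorComponents_sharp {z₀ : DualBundle F E}
    {ψ : Cotangent (modelDual B F) (DualBundle F E)}
    (hψ : IsCutoffPoint (B := B) F E z₀.proj ψ.proj.proj) :
    vectorComponents z₀ (𝔸.sharp ψ) = 𝔸.contraction z₀.proj ψ.proj (dualComponents z₀ ψ) := by
  obtain ⟨hproj, hlinear⟩ := 𝔸.isContraction_sharp ψ _ _ (contMDiff_cutoffLinear F E z₀.proj _)
    (differential_frame_add_cutoffLinear hψ)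
  have hz := mem_chartAt_dual_source.2 ⟨hψ.mem_baseSet, hψ.mem_source⟩
  refine Prod.ext ?_ (ContinuousLinearMap.ext fun y => ?_)
  · rw [vectorComponents_totalSpace_fst hz]
    refine (congrArg (fun v => vectorComponents z₀.proj (⟨ψ.proj.proj, v⟩ :
      TangentBundle 𝓘(ℝ, B) M)) hproj).trans ?_
    rw [← anchorComponents_components _ hψ.mem_baseSet hψ.mem_source, hψ.components_frame]
    rfl
  · have hy := hlinear (frame z₀.proj y)
    rw [tangentLift_anchor _ hψ.mem_baseSet hψ.mem_source _
      ((contMDiff_cutoffLinear F E z₀.proj _).mdifferentiableAt (by simp)), hψ.components_frame,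
      hψ.chartDeriv_cutoffLinear] at hy
    rw [contraction_snd_apply, bracketForm_apply]
    refine Eq.trans ?_ hy
    refine Eq.trans ?_ (tangentLift_eq_chartDeriv (u := 𝔸.sharp ψ) hz
      ((contMDiff_linearFunction _).mdifferentiableAt (by simp))).symm
    exact (hψ.chartDeriv_linearFunction_frame (z₀ := z₀) y _).symm

theorem sharp_eq (ψ : Cotangent (modelDual B F) (DualBundle F E)) :
    𝔸.sharp ψ = ⟨ψ.proj, 𝔸.contraction ψ.proj.proj ψ.proj ψ.snd⟩ := by
  have h := 𝔸.vectorComponents_sharp (z₀ := ψ.proj) (isCutoffPoint_self F E ψ.proj.proj)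
  rw [dualComponents_self] at h
  rw [← h]
  exact congrArg (TotalSpace.mk ψ.proj) (vectorComponents_self (𝔸.sharp ψ)).symm

end Sharp

end SkewAlgebroid

section FiniteDimensional

variable {W H : Type*} [NormedAddCommGroup W] [NormedSpace ℝ W] [TopologicalSpace H]
  {I : ModelWithCorners ℝ W H} {Q : Type*} [TopologicalSpace Q] [ChartedSpace H Q]
  {F : Type*} [NormedAddCommGroup F] [NormedSpace ℝ F] [FiniteDimensional ℝ F] {n : WithTop ℕ∞}

theorem contMDiffAt_of_dual_apply {f : Q → F} {q : Q}
    (hf : ∀ δ : F →L[ℝ] ℝ, ContMDiffAt I 𝓘(ℝ, ℝ) n (fun q => δ (f q)) q) :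
    ContMDiffAt I 𝓘(ℝ, F) n f q := by
  let b := Module.finBasis ℝ F
  have hsum : f = fun q => ∑ i, (b.coord i).toContinuousLinearMap (f q) • b i :=
    funext fun q => (b.sum_repr (f q)).symm
  rw [hsum]
  exact ContMDiffAt.sum fun i _ => (hf _).smul contMDiffAt_const

theorem contMDiffAt_clm_of_apply {G : Type*} [NormedAddCommGroup G] [NormedSpace ℝ G]
    {f : Q → F →L[ℝ] G} {q : Q} (hf : ∀ y, ContMDiffAt I 𝓘(ℝ, G) n (fun q => f q y) q) :
    ContMDiffAt I 𝓘(ℝ, F →L[ℝ] G) n f q := by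
  let b := Module.finBasis ℝ F
  let S (i : Fin (Module.finrank ℝ F)) : G →L[ℝ] F →L[ℝ] G :=
    ContinuousLinearMap.smulRightL ℝ F G (b.coord i).toContinuousLinearMap
  have hsum : f = fun q => ∑ i, S i (f q (b i)) := by
    ext q y
    conv_lhs => rw [← b.sum_repr y, map_sum]
    simp [S]
  rw [hsum]
  exact ContMDiffAt.sum fun i _ => (S i).contMDiff.contMDiffAt.comp q (hf (b i))

end FiniteDimensional

namespace SkewAlgebroid

section SmoothSharp

variable {B : Type*} [NormedAddCommGroup B] [NormedSpace ℝ B] [FiniteDimensional ℝ B]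
  {M : Type*} [TopologicalSpace M] [T2Space M] [ChartedSpace B M] [IsManifold 𝓘(ℝ, B) ∞ M]
  {F : Type*} [NormedAddCommGroup F] [NormedSpace ℝ F] [FiniteDimensional ℝ F]
  {E : M → Type*} [∀ x, AddCommGroup (E x)] [∀ x, Module ℝ (E x)] [∀ x, TopologicalSpace (E x)]
  [TopologicalSpace (TotalSpace F E)] [FiberBundle F E] [VectorBundle ℝ F E]
  [ContMDiffVectorBundle ∞ F E 𝓘(ℝ, B)] (𝔸 : SkewAlgebroid (B := B) F E)

theorem contMDiffAt_anchorComponents (x₀ : M) :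
    ContMDiffAt 𝓘(ℝ, B) 𝓘(ℝ, F →L[ℝ] B) ∞ (𝔸.anchorComponents x₀) x₀ := by
  refine contMDiffAt_clm_of_apply fun y => ?_
  refine (contMDiffAt_totalSpace.1 ((𝔸.contMDiff_anchor.comp
    (frame (B := B) (E := E) x₀ y).contMDiff) x₀)).2.congr_of_eventuallyEq ?_
  filter_upwards [(isCutoffPoint_self (B := B) F E x₀).eventually] with x hx
  have h := 𝔸.anchorComponents_components hx.mem_baseSet hx.mem_source (frame x₀ y)
  rw [hx.components_frame] at h
  exact h

theorem contMDiff_bracketForm (x₀ : M) :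
    ContMDiff (modelDual B F) 𝓘(ℝ, F →L[ℝ] F →L[ℝ] ℝ) ∞ (𝔸.bracketForm x₀) := fun _ =>
  contMDiffAt_clm_of_apply fun _ => contMDiffAt_clm_of_apply fun _ => contMDiff_linearFunction _ _

theorem contMDiff_sharp : ContMDiff ((modelDual B F).prod 𝓘(ℝ, (B × (F →L[ℝ] ℝ)) →L[ℝ] ℝ))
    (modelDual B F).tangent ∞ 𝔸.sharp := by
  intro ψ₀
  have hz : ContMDiffAt ((modelDual B F).prod 𝓘(ℝ, (B × (F →L[ℝ] ℝ)) →L[ℝ] ℝ)) (modelDual B F) ∞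
      (fun ψ : Cotangent (modelDual B F) (DualBundle F E) => ψ.proj) ψ₀ := contMDiffAt_proj _
  have hx : ContMDiffAt ((modelDual B F).prod 𝓘(ℝ, (B × (F →L[ℝ] ℝ)) →L[ℝ] ℝ)) 𝓘(ℝ, B) ∞
      (fun ψ : Cotangent (modelDual B F) (DualBundle F E) => ψ.proj.proj) ψ₀ :=
    (contMDiffAt_proj _).comp ψ₀ hz
  have ha := contMDiffAt_dualComponents (I := modelDual B F) (n := ∞) (z := ψ₀)
    (mem_baseSet_trivializationAt (B × (F →L[ℝ] ℝ)) (TangentSpace (modelDual B F)) ψ₀.proj)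
  have hanchor := (𝔸.contMDiffAt_anchorComponents ψ₀.proj.proj).comp ψ₀ hx
  have hbracket := (𝔸.contMDiff_bracketForm ψ₀.proj.proj).contMDiffAt.comp ψ₀ hz
  have hfibre : ContMDiffAt ((modelDual B F).prod 𝓘(ℝ, (B × (F →L[ℝ] ℝ)) →L[ℝ] ℝ)) 𝓘(ℝ, F) ∞
      (fun ψ => fibrePart (dualComponents ψ₀.proj ψ)) ψ₀ := contMDiffAt_of_dual_apply fun δ => by
    simpa only [apply_fibrePart] using ha.clm_apply contMDiffAt_const
  have hcontraction : ContMDiffAt ((modelDual B F).prod 𝓘(ℝ, (B × (F →L[ℝ] ℝ)) →L[ℝ] ℝ))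
      𝓘(ℝ, B × (F →L[ℝ] ℝ)) ∞ (fun ψ => 𝔸.contraction ψ₀.proj.proj ψ.proj
        (dualComponents ψ₀.proj ψ)) ψ₀ :=
    (hanchor.clm_apply hfibre).prodMk_space (contMDiffAt_clm_of_apply fun y =>
      ((hbracket.clm_apply hfibre).clm_apply contMDiffAt_const).sub
        (ha.clm_apply ((hanchor.clm_apply contMDiffAt_const).prodMk_space contMDiffAt_const)))
  refine contMDiffAt_totalSpace.2 ⟨hz, hcontraction.congr_of_eventuallyEq ?_⟩
  filter_upwards
    [hx.continuousAt.eventually (isCutoffPoint_self (B := B) F E ψ₀.proj.proj).eventually] with ψ hψ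
  exact 𝔸.vectorComponents_sharp hψ

end SmoothSharp

end SkewAlgebroid

section SecondDerivative

theorem hasFDerivAt_apply_snd {V G : Type*} [NormedAddCommGroup V] [NormedSpace ℝ V]
    [NormedAddCommGroup G] [NormedSpace ℝ G] {A : V → V →L[ℝ] G} {A' : V →L[ℝ] V →L[ℝ] G}
    {p : V × V} (hA : HasFDerivAt A A' p.1) :
    HasFDerivAt (fun p : V × V => A p.1 p.2)
      ((A p.1).comp (ContinuousLinearMap.snd ℝ V V) +
        (A'.comp (ContinuousLinearMap.fst ℝ V V)).flip p.2) p :=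
  (HasFDerivAt.comp p hA hasFDerivAt_fst).clm_apply hasFDerivAt_snd

variable {W H : Type*} [NormedAddCommGroup W] [NormedSpace ℝ W] [TopologicalSpace H]
  {I : ModelWithCorners ℝ W H} [I.Boundaryless] {Q : Type*} [TopologicalSpace Q]
  [ChartedSpace H Q] [IsManifold I 2 Q]

theorem hasFDerivAt_fderiv_comp_extChartAt_symm {G : Type*} [NormedAddCommGroup G]
    [NormedSpace ℝ G] {f : Q → G} {q₀ q : Q} (hq : q ∈ (chartAt H q₀).source)
    (hf : ContMDiffAt I 𝓘(ℝ, G) 2 f q) :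
    HasFDerivAt (fderiv ℝ (f ∘ (extChartAt I q₀).symm))
      (chartDeriv I (chartDeriv I f q₀) q₀ q) (extChartAt I q₀ q) := by
  have h := (((contDiffAt_comp_extChartAt_symm hq hf).fderiv_right
    (m := 1) (by norm_num)).differentiableAt one_ne_zero).hasFDerivAt
  rwa [← chartDeriv_eq_of_eventually (f := chartDeriv I f q₀) hq (.of_forall fun _ => rfl) h] at h

theorem chartDeriv_chartDeriv_comm {G : Type*} [NormedAddCommGroup G]
    [NormedSpace ℝ G] {f : Q → G} {q₀ q : Q} (hq : q ∈ (chartAt H q₀).source)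
    (hf : ContMDiffAt I 𝓘(ℝ, G) 2 f q) (v w : W) :
    chartDeriv I (chartDeriv I f q₀) q₀ q v w = chartDeriv I (chartDeriv I f q₀) q₀ q w v := by
  rw [← (hasFDerivAt_fderiv_comp_extChartAt_symm hq hf).fderiv]
  exact (contDiffAt_comp_extChartAt_symm hq hf).isSymmSndFDerivAt (by simp) v w

theorem hasMFDerivAt_tangentLift {f : Q → ℝ} {u : TangentBundle I Q}
    (hf : ContMDiffAt I 𝓘(ℝ, ℝ) 2 f u.proj) :
    HasMFDerivAt I.tangent 𝓘(ℝ, ℝ) (tangentLift I f) u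
      (ContinuousLinearMap.coprod (chartDeriv I (chartDeriv I f u.proj) u.proj u.proj u.snd)
        (chartDeriv I f u.proj u.proj) : W × W →L[ℝ] ℝ) := by
  have : IsManifold I 1 Q := .of_le (n := 2) (by norm_num)
  have hu := mem_chart_source H u.proj
  have hproj : ContinuousAt (fun u : TangentBundle I Q => u.proj) u :=
    (FiberBundle.continuous_proj W (TangentSpace I)).continuousAt
  have hchart (u' : TangentBundle I Q) (hu' : u'.proj ∈ (chartAt H u.proj).source) :
      extChartAt I.tangent u u' = (extChartAt I u.proj u'.proj, vectorComponents u.proj u') :=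
    extChartAt_totalSpace_apply (mem_baseSet_trivializationAt_tangent.2 hu')
  let g : W × W → ℝ := fun p => fderiv ℝ (f ∘ (extChartAt I u.proj).symm) p.1 p.2
  have hcoord : ∀ᶠ u' in 𝓝 u, tangentLift I f u' = g (extChartAt I.tangent u u') := by
    filter_upwards [hproj.eventually ((chartAt H u.proj).open_source.eventually_mem hu),
      hproj.eventually ((contMDiffAt_iff_contMDiffAt_nhds (by norm_num)).1 hf)] with u' hu' hf'
    rw [hchart u' hu']
    exact tangentLift_eq_chartDeriv hu' (hf'.mdifferentiableAt (by norm_num))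
  have hself : extChartAt I.tangent u u = (extChartAt I u.proj u.proj, (u.snd : W)) :=
    (hchart u hu).trans (congrArg (Prod.mk _) (vectorComponents_self u))
  have hderiv := hasFDerivAt_apply_snd (p := (extChartAt I u.proj u.proj, (u.snd : W)))
    (hasFDerivAt_fderiv_comp_extChartAt_symm hu hf)
  have hcoprod : (fderiv ℝ (f ∘ (extChartAt I u.proj).symm) (extChartAt I u.proj u.proj)).comp
        (ContinuousLinearMap.snd ℝ W W) + ((chartDeriv I (chartDeriv I f u.proj) u.proj u.proj).comp
          (ContinuousLinearMap.fst ℝ W W)).flip u.snd =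
      ContinuousLinearMap.coprod (chartDeriv I (chartDeriv I f u.proj) u.proj u.proj u.snd)
        (chartDeriv I f u.proj u.proj) :=
    ContinuousLinearMap.ext fun δ => (add_comm _ _).trans <| congrArg (· + _) <|
      chartDeriv_chartDeriv_comm hu hf δ.1 u.snd
  exact hasMFDerivAt_of_extChartAt_comp_eventuallyEq (I' := 𝓘(ℝ, ℝ)) (g := g)
    (.of_forall fun _ => mem_univ _) hcoord (by rw [hself]; exact hderiv.congr_fderiv hcoprod)

end SecondDerivative

section DualDifferential

open SkewAlgebroid

variable {B : Type*} [NormedAddCommGroup B] [NormedSpace ℝ B]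
  {M : Type*} [TopologicalSpace M] [ChartedSpace B M]
  {F : Type*} [NormedAddCommGroup F] [NormedSpace ℝ F]
  {E : M → Type*} [∀ x, AddCommGroup (E x)] [∀ x, Module ℝ (E x)] [∀ x, TopologicalSpace (E x)]
  [TopologicalSpace (TotalSpace F E)] [FiberBundle F E] [VectorBundle ℝ F E]
  {L : TotalSpace F E → ℝ}

theorem extChartAt_section {v₀ : TotalSpace F E} {x : M}
    (hx : x ∈ (trivializationAt F E v₀.proj).baseSet) (X : ContMDiffSection 𝓘(ℝ, B) F ∞ E) :
    extChartAt (modelE B F) v₀ ⟨x, X x⟩ =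
      (extChartAt 𝓘(ℝ, B) v₀.proj x, components v₀.proj X x) :=
  (extChartAt_totalSpace_apply (v := ⟨x, X x⟩) hx).trans
    (congrArg (Prod.mk _) (trivializationAt_snd_eq_continuousLinearMapAt (v := ⟨x, X x⟩) hx))

/-- The composition `R_E ∘ dL : E → T*E*`. -/
def dualDifferential (L : TotalSpace F E → ℝ) (v : TotalSpace F E) :
    Cotangent (modelDual B F) (DualBundle F E) :=
  dualityE (differential (modelE B F) L v)

variable [IsManifold 𝓘(ℝ, B) ∞ M] [ContMDiffVectorBundle ∞ F E 𝓘(ℝ, B)]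

theorem chartDeriv_comp_section {v₀ : TotalSpace F E} {x : M} (X : ContMDiffSection 𝓘(ℝ, B) F ∞ E)
    (hx : (⟨x, X x⟩ : TotalSpace F E) ∈ (chartAt (ModelProd B F) v₀).source)
    (hL : MDifferentiableAt (modelE B F) 𝓘(ℝ, ℝ) L ⟨x, X x⟩) (a : B) :
    chartDeriv 𝓘(ℝ, B) (fun x => L ⟨x, X x⟩) v₀.proj x a =
      chartDeriv (modelE B F) L v₀ ⟨x, X x⟩
        (a, chartDeriv 𝓘(ℝ, B) (components v₀.proj X) v₀.proj x a) := by
  obtain ⟨hb, hc⟩ := mem_chartAt_totalSpace_source.1 hx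
  have : IsManifold 𝓘(ℝ, B) 1 M := .of_le (n := ∞) (by norm_num)
  have : IsManifold (modelE B F) 1 (TotalSpace F E) := .of_le (n := ∞) (by norm_num)
  let graph (ξ : B) : B × F :=
    (ξ, (components v₀.proj X ∘ (extChartAt 𝓘(ℝ, B) v₀.proj).symm) ξ)
  have hgraph : HasFDerivAt graph
      ((ContinuousLinearMap.id ℝ B).prod
        (chartDeriv 𝓘(ℝ, B) (components v₀.proj X) v₀.proj x)) (extChartAt 𝓘(ℝ, B) v₀.proj x) :=
    (hasFDerivAt_id _).prodMk
      (hasFDerivAt_comp_extChartAt_symm hc (mdifferentiableAt_components hb X))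
  have hgraph_apply {x' : M} (hx' : (⟨x', X x'⟩ : TotalSpace F E) ∈
      (chartAt (ModelProd B F) v₀).source) : graph (extChartAt 𝓘(ℝ, B) v₀.proj x') =
        extChartAt (modelE B F) v₀ ⟨x', X x'⟩ := by
    obtain ⟨hb', hc'⟩ := mem_chartAt_totalSpace_source.1 hx'
    exact (congrArg (fun x => (extChartAt 𝓘(ℝ, B) v₀.proj x', components v₀.proj X x))
      (extChartAt_symm_extChartAt hc')).trans (extChartAt_section hb' X).symm
  have hL' := hasFDerivAt_comp_extChartAt_symm hx hL
  rw [← hgraph_apply hx] at hL'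
  refine DFunLike.congr_fun (chartDeriv_eq_of_eventually hc ?_
    (HasFDerivAt.comp (f := graph) _ hL' hgraph)) a
  filter_upwards [(trivializationAt F E v₀.proj).open_baseSet.mem_nhds hb,
    (chartAt B v₀.proj).open_source.mem_nhds hc] with x' hb' hc'
  have hx' := mem_chartAt_totalSpace_source.2
    (show (⟨x', X x'⟩ : TotalSpace F E).proj ∈ _ ∧ _ from ⟨hb', hc'⟩)
  rw [Function.comp_apply, Function.comp_apply, hgraph_apply hx', extChartAt_symm_extChartAt hx']

theorem dualComponents_dualDifferential {v₀ v : TotalSpace F E}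
    (hv : v ∈ (chartAt (ModelProd B F) v₀).source)
    (hL : MDifferentiableAt (modelE B F) 𝓘(ℝ, ℝ) L v) (y : F) :
    dualComponents v₀.proj (dualDifferential (B := B) L v).proj y =
      chartDeriv (modelE B F) L v₀ v (0, y) := by
  have : IsManifold (modelE B F) 1 (TotalSpace F E) := .of_le (n := ∞) (by norm_num)
  obtain ⟨hb, -⟩ := mem_chartAt_totalSpace_source.1 hv
  set e : E v.proj := (trivializationAt F E v₀.proj).symmL ℝ v.proj y
  have hy : (trivializationAt F E v₀.proj).continuousLinearMapAt ℝ v.proj e = y :=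
    Trivialization.continuousLinearMapAt_symmL _ hb y
  calc dualComponents v₀.proj (dualDifferential (B := B) L v).proj y
      = chartDeriv (modelE B F) L v v
          (0, (trivializationAt F E v.proj).continuousLinearMapAt ℝ v.proj e) :=
        (dualComponents_apply _ _ _).trans (DFunLike.congr_fun (mfderiv_eq_chartDeriv hL) _)
    _ = chartDeriv (modelE B F) L v₀ v
          (0, (trivializationAt F E v₀.proj).continuousLinearMapAt ℝ v.proj e) :=
        (chartDeriv_vertical (mem_chart_source _ v) hL e).trans (chartDeriv_vertical hv hL e).symm
    _ = chartDeriv (modelE B F) L v₀ v (0, y) := by rw [hy]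

theorem dualComponents_differential_linearFunction_sub {v₀ : TotalSpace F E} {x : M}
    (X : ContMDiffSection 𝓘(ℝ, B) F ∞ E)
    (hx : (⟨x, X x⟩ : TotalSpace F E) ∈ (chartAt (ModelProd B F) v₀).source)
    (hL : MDifferentiableAt (modelE B F) 𝓘(ℝ, ℝ) L ⟨x, X x⟩) (w : B × (F →L[ℝ] ℝ)) :
    dualComponents (dualDifferential (B := B) L v₀).proj (differential (modelDual B F)
        (fun z : DualBundle F E => linearFunction X z + -L ⟨z.proj, X z.proj⟩)
        (dualDifferential (B := B) L ⟨x, X x⟩).proj) w =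
      -chartDeriv (modelE B F) L v₀ ⟨x, X x⟩ (w.1, 0) + w.2 (components v₀.proj X x) := by
  have hLX : MDifferentiableAt 𝓘(ℝ, B) 𝓘(ℝ, ℝ) (fun x => -L ⟨x, X x⟩) x :=
    (hL.comp x (X.contMDiff.mdifferentiableAt (by simp))).neg
  have hz := mem_chartAt_dual_source.2 (show
    (dualDifferential (B := B) L ⟨x, X x⟩).proj.proj ∈ (trivializationAt F E
      (dualDifferential (B := B) L v₀).proj.proj).baseSet ∧ _ from
      mem_chartAt_totalSpace_source.1 hx)
  refine (dualComponents_differential_linearFunction_add hz X hLX w).trans ?_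
  set d : F := chartDeriv 𝓘(ℝ, B) (components v₀.proj X) v₀.proj x w.1
  have hvertical : dualComponents v₀.proj (dualDifferential (B := B) L ⟨x, X x⟩).proj d =
      chartDeriv (modelE B F) L v₀ ⟨x, X x⟩ (0, d) :=
    dualComponents_dualDifferential hx hL d
  have hbase : chartDeriv 𝓘(ℝ, B) (fun x => -L ⟨x, X x⟩) v₀.proj x w.1 =
      -(chartDeriv (modelE B F) L v₀ ⟨x, X x⟩ (w.1, 0) +
        chartDeriv (modelE B F) L v₀ ⟨x, X x⟩ (0, d)) := by
    rw [chartDeriv_neg, ← map_add, Prod.mk_add_mk, add_zero, zero_add]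
    exact congrArg Neg.neg (chartDeriv_comp_section X hx hL w.1)
  calc _ = chartDeriv (modelE B F) L v₀ ⟨x, X x⟩ (0, d) + w.2 (components v₀.proj X x) +
        -(chartDeriv (modelE B F) L v₀ ⟨x, X x⟩ (w.1, 0) +
          chartDeriv (modelE B F) L v₀ ⟨x, X x⟩ (0, d)) :=
      congrArg₂ (· + ·) (congrArg (· + _) hvertical) hbase
    _ = _ := by ring

theorem differential_linearFunction_sub_comp_section (X : ContMDiffSection 𝓘(ℝ, B) F ∞ E) {x : M}
    (hL : MDifferentiableAt (modelE B F) 𝓘(ℝ, ℝ) L ⟨x, X x⟩) :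
    differential (modelDual B F) (fun z : DualBundle F E => linearFunction X z +
      -L ⟨z.proj, X z.proj⟩) (dualDifferential (B := B) L ⟨x, X x⟩).proj =
        dualDifferential L ⟨x, X x⟩ := by
  set v : TotalSpace F E := ⟨x, X x⟩
  have hfibre : fibreCoord v = components x X x :=
    trivializationAt_snd_eq_continuousLinearMapAt (mem_baseSet_trivializationAt F E x)
  refine congrArg (TotalSpace.mk _) (ContinuousLinearMap.ext fun w => ?_)
  refine (DFunLike.congr_fun (dualComponents_self (I := modelDual B F) (differential
    (modelDual B F) _ (dualDifferential (B := B) L v).proj)) w).symm.trans ?_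
  refine (dualComponents_differential_linearFunction_sub (v₀ := v) X
    (mem_chart_source _ v) hL w).trans ?_
  exact (congrArg₂ (fun (a : B × F →L[ℝ] ℝ) y => -a (w.1, 0) + w.2 y)
    (mfderiv_eq_chartDeriv hL) hfibre).symm

variable [FiniteDimensional ℝ B] [T2Space M]

theorem dualComponents_dualDifferential_snd {v₀ v : TotalSpace F E}
    (hv : v ∈ (chartAt (ModelProd B F) v₀).source)
    (hL : MDifferentiableAt (modelE B F) 𝓘(ℝ, ℝ) L v) (w : B × (F →L[ℝ] ℝ)) :
    dualComponents (dualDifferential (B := B) L v₀).proj (dualDifferential (B := B) L v) w =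
      -chartDeriv (modelE B F) L v₀ v (w.1, 0) + w.2 (trivializationAt F E v₀.proj v).2 := by
  obtain ⟨X, hX⟩ : ∃ X : ContMDiffSection 𝓘(ℝ, B) F ∞ E, X v.proj = v.snd := by
    refine ⟨frame (B := B) v.proj (fibreCoord v), ?_⟩
    have hb := mem_baseSet_trivializationAt F E v.proj
    rw [(isCutoffPoint_self F E v.proj).frame_apply, fibreCoord,
      trivializationAt_snd_eq_continuousLinearMapAt hb,
      Trivialization.symmL_continuousLinearMapAt _ hb]
  obtain ⟨x, e⟩ := v
  obtain rfl : X x = e := hX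
  have hy : components v₀.proj X x = (trivializationAt F E v₀.proj ⟨x, X x⟩).2 :=
    (trivializationAt_snd_eq_continuousLinearMapAt (v := ⟨x, X x⟩)
      (mem_chartAt_totalSpace_source.1 hv).1).symm
  rw [← hy, ← dualComponents_differential_linearFunction_sub X hv hL w,
    differential_linearFunction_sub_comp_section X hL]

end DualDifferential

section TangentDualDifferential

variable (B F : Type*) [NormedAddCommGroup B] [NormedSpace ℝ B] [NormedAddCommGroup F]
  [NormedSpace ℝ F]

-- Instance search does not get through to these two at reducible transparency.
local instance : NormedAddCommGroup (B × (F →L[ℝ] ℝ) →L[ℝ] ℝ) :=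
  ContinuousLinearMap.toNormedAddCommGroup

local instance : NormedSpace ℝ (B × (F →L[ℝ] ℝ) →L[ℝ] ℝ) := ContinuousLinearMap.toNormedSpace

/-- The canonical isomorphism `R_E` in coordinates, `((x, y), (p, z)) ↦ ((x, z), (-p, y))`. -/
def dualityModel : (B × F) × (B × F →L[ℝ] ℝ) →L[ℝ]
    (B × (F →L[ℝ] ℝ)) × (B × (F →L[ℝ] ℝ) →L[ℝ] ℝ) :=
  ((ContinuousLinearMap.fst ℝ B F).prodMap
    (ContinuousLinearMap.precomp ℝ (ContinuousLinearMap.inr ℝ B F))).prod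
    ((ContinuousLinearMap.precomp ℝ (ContinuousLinearMap.snd ℝ B (F →L[ℝ] ℝ)) ∘L
      ContinuousLinearMap.apply ℝ ℝ ∘L ContinuousLinearMap.snd ℝ B F).coprod
      (-ContinuousLinearMap.precomp ℝ
        (ContinuousLinearMap.inl ℝ B F ∘L ContinuousLinearMap.fst ℝ B (F →L[ℝ] ℝ))))

variable {B F}

theorem dualityModel_apply (q : B × F) (a : B × F →L[ℝ] ℝ) :
    dualityModel B F (q, a) = ((q.1, a.comp (ContinuousLinearMap.inr ℝ B F)),
      (-(a.comp (ContinuousLinearMap.inl ℝ B F))).coprod (ContinuousLinearMap.apply ℝ ℝ q.2)) := by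
  refine Prod.ext rfl (ContinuousLinearMap.ext fun w => ?_)
  simp [dualityModel, add_comm]

variable {M : Type*} [TopologicalSpace M] [ChartedSpace B M] [IsManifold 𝓘(ℝ, B) ∞ M]
  {E : M → Type*} [∀ x, AddCommGroup (E x)] [∀ x, Module ℝ (E x)] [∀ x, TopologicalSpace (E x)]
  [TopologicalSpace (TotalSpace F E)] [FiberBundle F E] [VectorBundle ℝ F E]
  [ContMDiffVectorBundle ∞ F E 𝓘(ℝ, B)]

theorem alpha_symm_dualityTE (u : TangentBundle (modelE B F) (TotalSpace F E))
    (c c' : B × F →L[ℝ] ℝ) :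
    (alpha (modelDual B F) (DualBundle F E)).symm (dualityTE ⟨u, c.coprod c'⟩) =
      ⟨dualityE ⟨u.proj, c'⟩, dualityModel B F (u.snd, c)⟩ := by
  let lift (a a' : B × F →L[ℝ] ℝ) : TangentBundle ((modelDual B F).prod
      𝓘(ℝ, B × (F →L[ℝ] ℝ) →L[ℝ] ℝ)) (Cotangent (modelDual B F) (DualBundle F E)) :=
    ⟨dualityE ⟨u.proj, a'⟩, dualityModel B F (u.snd, a)⟩
  have hlift (a : (B × F) × (B × F) →L[ℝ] ℝ) :
      (alpha (modelDual B F) (DualBundle F E)).symm (dualityTE ⟨u, a⟩) =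
        lift (a.comp (ContinuousLinearMap.inl ℝ (B × F) (B × F)))
          (a.comp (ContinuousLinearMap.inr ℝ (B × F) (B × F))) :=
    (alpha (modelDual B F) (DualBundle F E)).symm_apply_eq.2 <|
      congrArg (fun w => alpha (modelDual B F) (DualBundle F E) ⟨dualityE ⟨u.proj, _⟩, w⟩)
        (dualityModel_apply u.snd (a.comp (ContinuousLinearMap.inl ℝ (B × F) (B × F)))).symm
  exact (hlift (c.coprod c')).trans (congrArg₂ lift
    (ContinuousLinearMap.coprod_comp_inl c c') (ContinuousLinearMap.coprod_comp_inr c c'))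

variable [FiniteDimensional ℝ B] [T2Space M] {L : TotalSpace F E → ℝ}

theorem extChartAt_dualDifferential {v₀ v : TotalSpace F E}
    (hv : v ∈ (chartAt (ModelProd B F) v₀).source)
    (hL : MDifferentiableAt (modelE B F) 𝓘(ℝ, ℝ) L v) :
    extChartAt ((modelDual B F).prod 𝓘(ℝ, B × (F →L[ℝ] ℝ) →L[ℝ] ℝ))
        (dualDifferential (B := B) L v₀) (dualDifferential (B := B) L v) =
      dualityModel B F (extChartAt (modelE B F) v₀ v, chartDeriv (modelE B F) L v₀ v) := by
  have hbase := mem_chartAt_totalSpace_source.1 hv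
  refine (extChartAt_totalSpace_apply (mem_baseSet_trivializationAt_dual.2
    (mem_baseSet_trivializationAt_tangent.2 (mem_chartAt_dual_source.2 hbase)))).trans ?_
  rw [dualityModel_apply]
  refine Prod.ext ((extChartAt_dual_apply (z := (dualDifferential (B := B) L v).proj)
    hbase.1).trans (Prod.ext ?_ ?_)) ?_
  · rw [extChartAt_totalSpace_apply hbase.1]
    rfl
  · exact ContinuousLinearMap.ext (dualComponents_dualDifferential hv hL)
  · refine ContinuousLinearMap.ext fun w => (dualComponents_dualDifferential_snd hv hL w).trans ?_
    rw [extChartAt_totalSpace_apply hbase.1]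
    rfl

theorem hasMFDerivAt_dualDifferential {v : TotalSpace F E}
    (hL : ContMDiffAt (modelE B F) 𝓘(ℝ, ℝ) 2 L v) :
    HasMFDerivAt (modelE B F) ((modelDual B F).prod 𝓘(ℝ, B × (F →L[ℝ] ℝ) →L[ℝ] ℝ))
      (dualDifferential (B := B) L) v (dualityModel B F ∘L (ContinuousLinearMap.id ℝ (B × F)).prod
        (chartDeriv (modelE B F) (chartDeriv (modelE B F) L v) v v)) := by
  have hsource : ∀ᶠ v' in 𝓝 v, v' ∈ (chartAt (ModelProd B F) v).source :=
    chart_source_mem_nhds (ModelProd B F) v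
  have hfderiv := hasFDerivAt_fderiv_comp_extChartAt_symm (mem_chart_source (ModelProd B F) v) hL
  refine hasMFDerivAt_of_extChartAt_comp_eventuallyEq
    (g := fun q => dualityModel B F (q, fderiv ℝ (L ∘ (extChartAt (modelE B F) v).symm) q)) ?_ ?_
    ((dualityModel B F).hasFDerivAt.comp (extChartAt (modelE B F) v v)
      ((hasFDerivAt_id (extChartAt (modelE B F) v v)).prodMk hfderiv))
  · filter_upwards [hsource] with v' hv'
    exact mem_chartAt_totalSpace_source.2
      ⟨mem_baseSet_trivializationAt_dual.2 (mem_baseSet_trivializationAt_tangent.2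
        (mem_chartAt_dual_source.2 (mem_chartAt_totalSpace_source.1 hv'))),
        mem_chartAt_dual_source.2 (mem_chartAt_totalSpace_source.1 hv')⟩
  · filter_upwards [hsource, (contMDiffAt_iff_contMDiffAt_nhds (by norm_num)).1 hL] with v' hv' hL'
    exact extChartAt_dualDifferential hv' (hL'.mdifferentiableAt (by norm_num))

theorem tangentMap_dualDifferential {u : TangentBundle (modelE B F) (TotalSpace F E)}
    (hL : ContMDiffAt (modelE B F) 𝓘(ℝ, ℝ) 2 L u.proj) :
    tangentMap (modelE B F) ((modelDual B F).prod 𝓘(ℝ, B × (F →L[ℝ] ℝ) →L[ℝ] ℝ))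
        (dualDifferential (B := B) L) u =
      (alpha (modelDual B F) (DualBundle F E)).symm (dualityTE
        (differential (modelE B F).tangent (tangentLift (modelE B F) L) u)) := by
  let c := chartDeriv (modelE B F) (chartDeriv (modelE B F) L u.proj) u.proj u.proj u.snd
  let c' := chartDeriv (modelE B F) L u.proj u.proj
  have hlift : differential (modelE B F).tangent (tangentLift (modelE B F) L) u =
      ⟨u, c.coprod c'⟩ := congrArg (TotalSpace.mk u) (hasMFDerivAt_tangentLift hL).mfderiv
  have hdual : dualDifferential (B := B) L u.proj = dualityE ⟨u.proj, c'⟩ :=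
    congrArg (fun a : B × F →L[ℝ] ℝ => dualityE ⟨u.proj, a⟩)
      (mfderiv_eq_chartDeriv (hL.mdifferentiableAt (by norm_num)))
  rw [hlift, alpha_symm_dualityTE]
  exact congrArg₂ (fun ψ w => (⟨ψ, w⟩ : TangentBundle ((modelDual B F).prod
      𝓘(ℝ, B × (F →L[ℝ] ℝ) →L[ℝ] ℝ)) (Cotangent (modelDual B F) (DualBundle F E)))) hdual
    (DFunLike.congr_fun (hasMFDerivAt_dualDifferential hL).mfderiv u.snd)

end TangentDualDifferential

section EulerLagrangeEquation

variable {B : Type*} [NormedAddCommGroup B] [NormedSpace ℝ B] [FiniteDimensional ℝ B]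
  {M : Type*} [TopologicalSpace M] [T2Space M] [ChartedSpace B M] [IsManifold 𝓘(ℝ, B) ∞ M]
  {F : Type*} [NormedAddCommGroup F] [NormedSpace ℝ F] [FiniteDimensional ℝ F]
  {E : M → Type*} [∀ x, AddCommGroup (E x)] [∀ x, Module ℝ (E x)] [∀ x, TopologicalSpace (E x)]
  [TopologicalSpace (TotalSpace F E)] [FiberBundle F E] [VectorBundle ℝ F E]
  [ContMDiffVectorBundle ∞ F E 𝓘(ℝ, B)]

namespace SkewAlgebroid

variable (𝔸 : SkewAlgebroid (B := B) F E) {L : TotalSpace F E → ℝ}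

theorem mdifferentiableAt_tulczyjew {v : TotalSpace F E}
    (hL : ContMDiffAt (modelE B F) 𝓘(ℝ, ℝ) 2 L v) :
    MDifferentiableAt (modelE B F) (modelDual B F).tangent (tulczyjew 𝔸.eps L) v :=
  MDifferentiableAt.comp (I' := (modelDual B F).prod 𝓘(ℝ, B × (F →L[ℝ] ℝ) →L[ℝ] ℝ))
    (g := 𝔸.sharp) (f := dualDifferential (B := B) L) v
    (𝔸.contMDiff_sharp.mdifferentiableAt (by simp))
    (hasMFDerivAt_dualDifferential hL).mdifferentiableAt

theorem kappa_tangentMap_tulczyjew {u : TangentBundle (modelE B F) (TotalSpace F E)}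
    (hL : ContMDiffAt (modelE B F) 𝓘(ℝ, ℝ) 2 L u.proj) :
    kappa (modelDual B F) (DualBundle F E)
        (tangentMap (modelE B F) (modelDual B F).tangent (tulczyjew 𝔸.eps L) u) =
      tulczyjew 𝔸.liftEps (tangentLift (modelE B F) L) u := by
  have hcomp := tangentMap_comp_at (I' := (modelDual B F).prod 𝓘(ℝ, B × (F →L[ℝ] ℝ) →L[ℝ] ℝ)) u
    (𝔸.contMDiff_sharp.mdifferentiableAt (x := dualDifferential (B := B) L u.proj) (by simp))
    (hasMFDerivAt_dualDifferential hL).mdifferentiableAt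
  exact congrArg (kappa (modelDual B F) (DualBundle F E))
    (hcomp.trans (congrArg _ (tangentMap_dualDifferential hL)))

theorem tangentMap_legendre {u : TangentBundle (modelE B F) (TotalSpace F E)}
    (hL : ContMDiffAt (modelE B F) 𝓘(ℝ, ℝ) 2 L u.proj) :
    tangentMap (modelE B F) (modelDual B F) (legendre 𝔸.eps L) u =
      legendre 𝔸.liftEps (tangentLift (modelE B F) L) u := by
  refine Eq.trans ?_ (congrArg TotalSpace.proj (𝔸.kappa_tangentMap_tulczyjew hL))
  have hproj := hasMFDerivAt_totalSpace_proj (I := modelDual B F) (tulczyjew 𝔸.eps L u.proj)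
  refine (tangentMap_comp_at (I' := (modelDual B F).tangent) u hproj.mdifferentiableAt
    (𝔸.mdifferentiableAt_tulczyjew hL)).trans ?_
  exact congrArg (TotalSpace.mk (legendre 𝔸.eps L u.proj)) (DFunLike.congr_fun hproj.mfderiv _)

theorem isProlongedELSolution_iff (hL : ContMDiff (modelE B F) 𝓘(ℝ, ℝ) 2 L) (t₀ t₁ : ℝ)
    (J : ℝ → TangentBundle (modelE B F) (TotalSpace F E)) :
    IsProlongedELSolution 𝔸.eps L t₀ t₁ J ↔
      IsELSolution 𝔸.liftEps (tangentLift (modelE B F) L) t₀ t₁ J := by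
  have hlegendre : (fun s => tangentMap (modelE B F) (modelDual B F) (legendre 𝔸.eps L) (J s)) =
      fun s => legendre 𝔸.liftEps (tangentLift (modelE B F) L) (J s) :=
    funext fun s => 𝔸.tangentMap_legendre (hL (J s).proj)
  unfold IsProlongedELSolution IsELSolution
  rw [hlegendre]
  exact forall₂_congr fun t _ => and_congr_right fun _ => by
    rw [𝔸.kappa_tangentMap_tulczyjew (hL (J t).proj)]

end SkewAlgebroid

end EulerLagrangeEquation

section Velocity

variable {W H W' H' : Type*} [NormedAddCommGroup W] [NormedSpace ℝ W] [TopologicalSpace H]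
  {I : ModelWithCorners ℝ W H} {Q : Type*} [TopologicalSpace Q] [ChartedSpace H Q]
  [NormedAddCommGroup W'] [NormedSpace ℝ W'] [TopologicalSpace H']
  {I' : ModelWithCorners ℝ W' H'} {Q' : Type*} [TopologicalSpace Q'] [ChartedSpace H' Q']

theorem velocity_congr {c c' : ℝ → Q} {s : Set ℝ} {t : ℝ} (h : ∀ r ∈ s, c r = c' r) (ht : t ∈ s) :
    velocity I c s t = velocity I c' s t := by
  have hderiv : mfderivWithin 𝓘(ℝ, ℝ) I c s t (1 : ℝ) = mfderivWithin 𝓘(ℝ, ℝ) I c' s t (1 : ℝ) :=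
    congrArg (fun A : ℝ →L[ℝ] W => A 1) (mfderivWithin_congr (I := 𝓘(ℝ, ℝ)) (I' := I) h (h t ht))
  exact congrArg₂ (fun (q : Q) (w : W) => (⟨q, w⟩ : TangentBundle I Q)) (h t ht) hderiv

theorem tangentMap_velocity {f : Q → Q'} {c : ℝ → Q} {s : Set ℝ} {t : ℝ}
    (hf : MDifferentiableAt I I' f (c t)) (hc : MDifferentiableWithinAt 𝓘(ℝ, ℝ) I c s t)
    (hs : UniqueDiffWithinAt ℝ s t) :
    tangentMap I I' f (velocity I c s t) = velocity I' (fun r => f (c r)) s t :=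
  congrArg (TotalSpace.mk (f (c t)))
    (DFunLike.congr_fun (mfderiv_comp_mfderivWithin t hf hc hs.uniqueMDiffWithinAt) (1 : ℝ)).symm

end Velocity

section AdmissibleVariation

variable {B : Type*} [NormedAddCommGroup B] [NormedSpace ℝ B]
  {M : Type*} [TopologicalSpace M] [ChartedSpace B M]
  {F : Type*} [NormedAddCommGroup F] [NormedSpace ℝ F]
  {E : M → Type*} [∀ x, AddCommGroup (E x)] [∀ x, Module ℝ (E x)] [∀ x, TopologicalSpace (E x)]
  [TopologicalSpace (TotalSpace F E)] [FiberBundle F E] [VectorBundle ℝ F E]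

theorem symmL_fibreCoord (v : TotalSpace F E) :
    (trivializationAt F E v.proj).symmL ℝ v.proj (fibreCoord v) = v.snd := by
  have hv := mem_baseSet_trivializationAt F E v.proj
  rw [fibreCoord, trivializationAt_snd_eq_continuousLinearMapAt hv]
  exact Trivialization.symmL_continuousLinearMapAt _ hv v.snd

theorem dualCoord_dualityE_apply (v : TotalSpace F E) (A : B × F →L[ℝ] ℝ) (y : F) :
    dualCoord (dualityE (⟨v, A⟩ : Cotangent (modelE B F) (TotalSpace F E))).proj y = A (0, y) :=
  (dualComponents_apply v.proj _ y).trans (congrArg (fun y => A (0, y))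
    (Trivialization.continuousLinearMapAt_symmL _ (mem_baseSet_trivializationAt F E v.proj) y))

theorem fibrePart_dualityE [FiniteDimensional ℝ F]
    (A : Cotangent (modelE B F) (TotalSpace F E)) :
    fibrePart (dualityE A).snd = fibreCoord A.proj :=
  fibrePart_eq_iff.2 fun δ => by
    rw [dualityE, ContinuousLinearMap.coprod_apply, map_zero, zero_add,
      ContinuousLinearMap.apply_apply]

namespace SkewAlgebroid

variable [IsManifold 𝓘(ℝ, B) ∞ M] (𝔸 : SkewAlgebroid (B := B) F E)

theorem anchorComponents_fibreCoord (v : TotalSpace F E) :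
    𝔸.anchorComponents v.proj v.proj (fibreCoord v) = 𝔸.anchor v.proj v.snd := by
  rw [anchorComponents, ContinuousLinearMap.comp_apply, ContinuousLinearMap.comp_apply,
    symmL_fibreCoord]
  refine Eq.trans ?_ (vectorComponents_self (𝔸.rho v))
  exact (trivializationAt_snd_eq_continuousLinearMapAt (v := 𝔸.rho v)
    (mem_baseSet_trivializationAt B (TangentSpace 𝓘(ℝ, B)) v.proj)).symm

/-- A curve `γ` in `E` is admissible on `s` if its base path is integral for the anchor:
`ρ ∘ γ = d/dt (τ ∘ γ)`. -/
def IsAdmissible (s : Set ℝ) (γ : ℝ → TotalSpace F E) : Prop :=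
  ∀ t ∈ s, 𝔸.rho (γ t) = velocity 𝓘(ℝ, B) (fun r => (γ r).proj) s t

variable {𝔸} in
theorem IsAdmissible.rho_eq_tangentMap_velocity {s : Set ℝ} (hs : UniqueDiffOn ℝ s)
    {γ η : ℝ → TotalSpace F E} (hγ : 𝔸.IsAdmissible s γ)
    (hproj : ∀ t ∈ s, (η t).proj = (γ t).proj) (hη : MDifferentiableOn 𝓘(ℝ, ℝ) (modelE B F) η s)
    {t : ℝ} (ht : t ∈ s) :
    𝔸.rho (γ t) = tangentMap (modelE B F) 𝓘(ℝ, B) (fun v : TotalSpace F E => v.proj)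
      (velocity (modelE B F) η s t) := by
  rw [tangentMap_velocity (hasMFDerivAt_totalSpace_proj (η t)).mdifferentiableAt (hη t ht)
    (hs t ht), hγ t ht, velocity_congr hproj ht]

variable [FiniteDimensional ℝ B] [T2Space M] [FiniteDimensional ℝ F]
  [ContMDiffVectorBundle ∞ F E 𝓘(ℝ, B)]

theorem eps_eq (A : Cotangent (modelE B F) (TotalSpace F E)) :
    𝔸.eps A = ⟨(dualityE A).proj,
      𝔸.contraction A.proj.proj (dualityE A).proj (dualityE A).snd⟩ :=
  𝔸.sharp_eq _

theorem tangentMap_proj_eps (A : Cotangent (modelE B F) (TotalSpace F E)) :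
    tangentMap (modelDual B F) 𝓘(ℝ, B) (fun z : DualBundle F E => z.proj) (𝔸.eps A) =
      𝔸.rho A.proj := by
  rw [eps_eq]
  refine congrArg (fun w : B => (⟨A.proj.proj, w⟩ : TangentBundle 𝓘(ℝ, B) M)) ?_
  refine (DFunLike.congr_fun (hasMFDerivAt_totalSpace_proj _).mfderiv _).trans ?_
  refine Eq.trans ?_ (𝔸.anchorComponents_fibreCoord A.proj)
  exact congrArg (𝔸.anchorComponents A.proj.proj A.proj.proj) (fibrePart_dualityE A)

theorem isAdmissible_of_isELSolution {L : TotalSpace F E → ℝ} {t₀ t₁ : ℝ} (h : t₀ < t₁)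
    {γ : ℝ → TotalSpace F E} (hγ : IsELSolution 𝔸.eps L t₀ t₁ γ) :
    𝔸.IsAdmissible (Icc t₀ t₁) γ := fun t ht => by
  obtain ⟨hdiff, heq⟩ := hγ t ht
  have hproj := (hasMFDerivAt_totalSpace_proj (I := 𝓘(ℝ, B))
    (legendre 𝔸.eps L (γ t))).mdifferentiableAt
  exact (𝔸.tangentMap_proj_eps (differential (modelE B F) L (γ t))).symm.trans
    ((congrArg _ heq).symm.trans (tangentMap_velocity hproj hdiff (uniqueDiffOn_Icc h t ht)))

/-- The vector at `v` that represents the linear form `A ↦ ⟨X, ε(A)⟩` on covectors at `v`: in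
induced coordinates, with `y` and `y'` the fibre coordinates of `v` and `X`, it is
`(ρ(y'), ẏ' + [y, y'])`, the bracket being that of the sections with constant components near the
base point. -/
def kappaVector (v : TotalSpace F E) (X : TangentBundle (modelE B F) (TotalSpace F E)) : B × F :=
  let X' : B × F := X.snd
  (𝔸.anchorComponents v.proj v.proj (fibreCoord X.proj),
    X'.2 + (trivializationAt F E v.proj).continuousLinearMapAt ℝ v.proj
      (𝔸.bracket (frame v.proj (fibreCoord v)) (frame v.proj (fibreCoord X.proj)) v.proj))

theorem tangentPairing_eps (v : TotalSpace F E)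
    (X : TangentBundle (modelE B F) (TotalSpace F E)) (A : B × F →L[ℝ] ℝ) :
    tangentPairing X (𝔸.eps ⟨v, A⟩) = A (𝔸.kappaVector v X) := by
  let Ψ := dualityE (⟨v, A⟩ : Cotangent (modelE B F) (TotalSpace F E))
  let y' := fibreCoord X.proj
  let b := 𝔸.anchorComponents v.proj v.proj y'
  let e := (trivializationAt F E v.proj).continuousLinearMapAt ℝ v.proj
    (𝔸.bracket (frame v.proj (fibreCoord v)) (frame v.proj y') v.proj)
  let dy : F := (show B × F from X.snd).2
  have hvertical : dualCoord Ψ.proj dy = A (0, dy) := dualCoord_dualityE_apply v A dy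
  have hbracket : 𝔸.bracketForm v.proj Ψ.proj (fibrePart Ψ.snd) y' = A (0, e) :=
    congrArg (fun y => 𝔸.bracketForm v.proj Ψ.proj y y') (fibrePart_dualityE _)
  have hanchor : (show B × (F →L[ℝ] ℝ) →L[ℝ] ℝ from Ψ.snd) (b, 0) = -A (b, 0) :=
    add_zero (-A (b, 0))
  calc tangentPairing X (𝔸.eps ⟨v, A⟩)
    _ = dualCoord Ψ.proj dy + (𝔸.contraction v.proj Ψ.proj Ψ.snd).2 y' := by rw [eps_eq]; rfl
    _ = A (0, dy) + (A (0, e) - -A (b, 0)) :=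
      congrArg₂ (· + ·) hvertical (congrArg₂ (· - ·) hbracket hanchor)
    _ = A ((0, dy) + ((0, e) + (b, 0))) := by rw [sub_neg_eq_add, map_add, map_add]
    _ = A (b, dy + e) := by simp

theorem kappaRel_mk_iff {v : TotalSpace F E} {X : TangentBundle (modelE B F) (TotalSpace F E)}
    (hX : 𝔸.rho v = tangentMap (modelE B F) 𝓘(ℝ, B) (fun v : TotalSpace F E => v.proj) X)
    (Y : TangentSpace (modelE B F) v) :
    𝔸.KappaRel X ⟨v, Y⟩ ↔ Y = 𝔸.kappaVector v X := by
  refine (and_iff_right hX).trans (Iff.trans ?_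
    (SeparatingDual.eq_iff_forall_dual_eq (R := ℝ) (V := B × F)).symm)
  exact forall_congr' fun A => (𝔸.tangentPairing_eps v X A).congr_left.trans eq_comm

theorem admissibleVariation_eq {s : Set ℝ} {γ η : ℝ → TotalSpace F E} {t : ℝ}
    (h : 𝔸.rho (γ t) = tangentMap (modelE B F) 𝓘(ℝ, B) (fun v : TotalSpace F E => v.proj)
      (velocity (modelE B F) η s t)) :
    𝔸.admissibleVariation s γ η t = ⟨γ t, 𝔸.kappaVector (γ t) (velocity (modelE B F) η s t)⟩ :=
  congrArg (TotalSpace.mk (γ t)) ((𝔸.kappaRel_mk_iff h _).1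
    (Classical.epsilon_spec (p := fun Y : TangentSpace (modelE B F) (γ t) =>
      𝔸.KappaRel (velocity (modelE B F) η s t) ⟨γ t, Y⟩) ⟨_, (𝔸.kappaRel_mk_iff h _).2 rfl⟩))

theorem proj_eq_and_kappaRel_iff {s : Set ℝ} {γ η : ℝ → TotalSpace F E} {t : ℝ}
    (h : 𝔸.rho (γ t) = tangentMap (modelE B F) 𝓘(ℝ, B) (fun v : TotalSpace F E => v.proj)
      (velocity (modelE B F) η s t)) (Y : TangentBundle (modelE B F) (TotalSpace F E)) :
    Y.proj = γ t ∧ 𝔸.KappaRel (velocity (modelE B F) η s t) Y ↔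
      Y = 𝔸.admissibleVariation s γ η t := by
  rw [𝔸.admissibleVariation_eq h]
  constructor
  · obtain ⟨v, Y⟩ := Y
    rintro ⟨hv, hκ⟩
    obtain rfl : v = γ t := hv
    exact congrArg (TotalSpace.mk (γ t)) ((𝔸.kappaRel_mk_iff h Y).1 hκ)
  · rintro rfl
    exact ⟨rfl, (𝔸.kappaRel_mk_iff h _).2 rfl⟩

end SkewAlgebroid

end AdmissibleVariation

end SkewAlg

end

theorem mainTheorem1_general {B : Type*} [NormedAddCommGroup B] [NormedSpace ℝ B]
    [FiniteDimensional ℝ B]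
    {M : Type*} [TopologicalSpace M] [T2Space M] [ChartedSpace B M] [IsManifold 𝓘(ℝ, B) ∞ M]
    {F : Type*} [NormedAddCommGroup F] [NormedSpace ℝ F] [FiniteDimensional ℝ F]
    {E : M → Type*} [∀ x, AddCommGroup (E x)] [∀ x, Module ℝ (E x)] [∀ x, TopologicalSpace (E x)]
    [TopologicalSpace (TotalSpace F E)] [FiberBundle F E] [VectorBundle ℝ F E]
    [ContMDiffVectorBundle ∞ F E 𝓘(ℝ, B)]
    (𝔸 : SkewAlg.SkewAlgebroid F E)
    (L : TotalSpace F E → ℝ) (hL : ContMDiff (SkewAlg.modelE B F) 𝓘(ℝ, ℝ) 2 L)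
    (t₀ t₁ : ℝ) (ht : t₀ < t₁) :
    (∀ J : ℝ → TangentBundle (SkewAlg.modelE B F) (TotalSpace F E),
      SkewAlg.IsProlongedELSolution 𝔸.eps L t₀ t₁ J ↔
        SkewAlg.IsELSolution 𝔸.liftEps (SkewAlg.tangentLift (SkewAlg.modelE B F) L) t₀ t₁ J) ∧
    ∀ γ : ℝ → TotalSpace F E, 𝔸.IsAdmissible (Icc t₀ t₁) γ →
      ∀ η : ℝ → TotalSpace F E, (∀ t ∈ Icc t₀ t₁, (η t).proj = (γ t).proj) →
        MDifferentiableOn 𝓘(ℝ, ℝ) (SkewAlg.modelE B F) η (Icc t₀ t₁) →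
        (∀ t ∈ Icc t₀ t₁, ∀ Y : TangentBundle (SkewAlg.modelE B F) (TotalSpace F E),
          Y.proj = γ t ∧
              𝔸.KappaRel (SkewAlg.velocity (SkewAlg.modelE B F) η (Icc t₀ t₁) t) Y ↔
            Y = 𝔸.admissibleVariation (Icc t₀ t₁) γ η t) ∧
        (𝔸.IsJacobiField L t₀ t₁ γ η ↔
          SkewAlg.IsELSolution 𝔸.liftEps (SkewAlg.tangentLift (SkewAlg.modelE B F) L) t₀ t₁
            (𝔸.admissibleVariation (Icc t₀ t₁) γ η)) := by
  have prolonged_iff := 𝔸.isProlongedELSolution_iff hL t₀ t₁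
  refine ⟨prolonged_iff, fun γ hγ η hproj hη => ⟨fun t h Y => ?_, ?_⟩⟩
  · exact 𝔸.proj_eq_and_kappaRel_iff
      (hγ.rho_eq_tangentMap_velocity (uniqueDiffOn_Icc ht) hproj hη h) Y
  · rw [← prolonged_iff]
    exact ⟨fun h => h.2.2, fun h => ⟨hproj, hη, h⟩⟩

theorem mainTheorem1 {B : Type*} [NormedAddCommGroup B] [NormedSpace ℝ B] [FiniteDimensional ℝ B]
    {M : Type*} [TopologicalSpace M] [T2Space M] [ChartedSpace B M] [IsManifold 𝓘(ℝ, B) ∞ M]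
    {F : Type*} [NormedAddCommGroup F] [NormedSpace ℝ F] [FiniteDimensional ℝ F]
    {E : M → Type*} [∀ x, AddCommGroup (E x)] [∀ x, Module ℝ (E x)] [∀ x, TopologicalSpace (E x)]
    [TopologicalSpace (TotalSpace F E)] [FiberBundle F E] [VectorBundle ℝ F E]
    [ContMDiffVectorBundle ∞ F E 𝓘(ℝ, B)]
    (𝔸 : SkewAlg.SkewAlgebroid F E)
    (L : TotalSpace F E → ℝ) (hL : ContMDiff (SkewAlg.modelE B F) 𝓘(ℝ, ℝ) ∞ L)
    (t₀ t₁ : ℝ) (ht : t₀ < t₁) :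
    (∀ J : ℝ → TangentBundle (SkewAlg.modelE B F) (TotalSpace F E),
      SkewAlg.IsProlongedELSolution 𝔸.eps L t₀ t₁ J ↔
        SkewAlg.IsELSolution 𝔸.liftEps (SkewAlg.tangentLift (SkewAlg.modelE B F) L) t₀ t₁ J) ∧
    ∀ γ : ℝ → TotalSpace F E, SkewAlg.IsELSolution 𝔸.eps L t₀ t₁ γ →
      ∀ η : ℝ → TotalSpace F E, (∀ t ∈ Icc t₀ t₁, (η t).proj = (γ t).proj) →
        MDifferentiableOn 𝓘(ℝ, ℝ) (SkewAlg.modelE B F) η (Icc t₀ t₁) →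
        (∀ t ∈ Icc t₀ t₁, ∀ Y : TangentBundle (SkewAlg.modelE B F) (TotalSpace F E),
          Y.proj = γ t ∧
              𝔸.KappaRel (SkewAlg.velocity (SkewAlg.modelE B F) η (Icc t₀ t₁) t) Y ↔
            Y = 𝔸.admissibleVariation (Icc t₀ t₁) γ η t) ∧
        (𝔸.IsJacobiField L t₀ t₁ γ η ↔
          SkewAlg.IsELSolution 𝔸.liftEps (SkewAlg.tangentLift (SkewAlg.modelE B F) L) t₀ t₁
            (𝔸.admissibleVariation (Icc t₀ t₁) γ η)) := by
  obtain ⟨prolonged_iff, jacobi_iff⟩ :=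
    mainTheorem1_general 𝔸 L (hL.of_le ENat.LEInfty.out) t₀ t₁ ht
  exact ⟨prolonged_iff, fun γ hγ => jacobi_iff γ (𝔸.isAdmissible_of_isELSolution ht hγ)⟩
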